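/- **Setting.** Let $T>0$ and let $X=(X_t)_{t\in[0,T]}$ be a measurable centered Gaussian process with $X_0=0$ on a probability space $(\Omega,\mathcal F,P)$; $\mathcal F^X_t$ is the $\sigma$-field generated by $X_s$, $s\le t$, and measurability with respect to it is understood up to $P$-null sets. Put $L^2_X=L^2(\Omega,\mathcal F^X_T,P)$. Let $\mathfrak H$ be the Hilbert space completion of the span of the indicators $\mathbf 1_{(0,t]}$, $t\in[0,T]$, for $\langle \mathbf 1_{(0,t]},\mathbf 1_{(0,s]}\rangle=E[X_tX_s]$, let $I:\mathfrak H\to L^2_X$ be the isometry with $I(\mathbf 1_{(0,t]})=X_t$, and for $\mathfrak h\in\mathfrak H$ let $\underline h(t)=E[X_tI(\mathfrak h)]$ be the associated element of the Cameron–Martin space (whose norm is $\|\underline h\|=\|\mathfrak h\|$). The $S$-transform of $\xi\in L^2_X$ is $(S\xi)(\mathfrak h)=E[\xi\, e^{I(\mathfrak h)-\frac12E[I(\mathfrak h)^2]}]$; the same formula, read in a Hilbert space $\mathcal H$, defines $(SZ)(\mathfrak h)\in\mathcal H$ for $Z\in L^2(\Omega,\mathcal H)=L^2_X\otimes\mathcal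 H$. *Spaces of integrands.* A Hilbert space $\mathcal H$ in which the indicators $\mathbf 1_{(0,t]}$, $t\in[0,T]$, are total is a *space of integrands* for $\underline h$ if $\mathbf 1_{(0,t]}\mapsto\underline h(t)$ extends to a continuous linear functional $\int_0^T\cdot\,d^{\mathcal H}\underline h$ on $\mathcal H$. It is *appropriate* for $X$ if $\mathcal C_{\mathcal H}=\{\mathfrak h\in\mathfrak H:\mathcal H\text{ is a space of integrands for }\underline h\}$ is dense in $\mathfrak H$. It satisfies $(\mathrm I_{\mathcal H})$ if for every $r\in[0,T]$ there is a continuous linear operator $\mathcal I^{\mathcal H}_r$ on $\mathcal H$ with $\mathcal I^{\mathcal H}_r\mathbf 1_{(0,t]}=\mathbf 1_{(0,t\wedge r]}$ for all $t$; then $\mathcal I^{\mathcal H}_{(t,T]}=\mathcal I^{\mathcal H}_T-\mathcal I^{\mathcal H}_t$. The $\mathcal H$-Skorokhod integral $\int_0^TZ\,d^{\diamond_{\mathcal H}}X$ of $Z\in L^2(\Omega,\mathcal H)$ is the element $\zeta\in L^2_X$, if it exists, with $(S\zeta)(\mathfrak h)=\int_0^T(SZ)(\mathfrak h)\,d^{\mathcal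 H}\underline h$ for all $\mathfrak h\in\mathcal C_{\mathcal H}$. Put $\int_t^TZ\,d^{\diamond_{\mathcal H}}X=\int_0^T\mathcal I^{\mathcal H}_{(t,T]}Z\,d^{\diamond_{\mathcal H}}X$ and $\int_t^TZ\,d^{\mathcal H}\underline c=\int_0^T\mathcal I^{\mathcal H}_{(t,T]}Z\,d^{\mathcal H}\underline c$. *Quasi-conditional expectation.* Assume that $X$ has an indefinite Wiener integral, i.e. that $\mathfrak H$ satisfies $(\mathrm I_{\mathfrak H})$, and write $\mathfrak h^r=(\mathcal I^{\mathfrak H}_r)^*\mathfrak h$. For $\mathfrak c\in\mathfrak H$ and $r\in[0,T]$, $D^{\mathfrak c}_r$ is the set of all $\xi\in L^2_X$ for which there is $\eta\in L^2_X$ with $(S\xi)((\mathfrak h+\mathfrak c)^r-\mathfrak c)=(S\eta)(\mathfrak h)$ for all $\mathfrak h\in\mathfrak H$; this unique $\eta$ is denoted $\widetilde E^{\mathfrak c}[\xi\mid\mathcal F^X_r]$. *The BSDE.* Let $\mathfrak c\in\mathfrak H$, let $\gamma:[0,T]\to\mathbb R$ be continuous and of bounded variation with total variation measure $|\gamma|$,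 let $a:[0,T]\to\mathbb R$ be measurable, let $G$ be a measurable process adapted to $(\mathcal F^X_t)$, with $$\int_0^T|a(s)|\,d|\gamma|(s)+E\Big[\Big(\int_0^T|G_s|\,d|\gamma|(s)\Big)^2\Big]<\infty,$$ and let $\xi\in L^2_X$. A triplet $(Y,Z,\mathcal H)$ is a *mild solution* of $$dY_t=(a(t)Y_t+G_t)\,d\gamma(t)+Z\,d\underline c(t)+Z\,d^{\diamond}X_t,\qquad Y_T=\xi,$$ if: $\mathcal H$ is appropriate for $X$, satisfies $(\mathrm I_{\mathcal H})$ and is a space of integrands for $\underline c$; $Y$ is a measurable adapted process with $Y_t\in L^2_X$ for every $t$ and $E[(\int_0^T|a(s)Y_s|\,d|\gamma|(s))^2]<\infty$; $Z\in L^2(\Omega,\mathcal H)$ and $\int_t^TZ\,d^{\diamond_{\mathcal H}}X$ exists for every $t\in[0,T]$; and for every $t\in[0,T]$, almost surely, $$Y_t=\xi-\int_t^T(a(s)Y_s+G_s)\,d\gamma(s)-\int_t^TZ\,d^{\mathcal H}\underline c-\int_t^TZ\,d^{\diamond_{\mathcal H}}X.$$ **Theorem 3.6.** Suppose that $X$ has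 an indefinite Wiener integral and that $(Y,Z,\mathcal H)$ is a mild solution of the linear BSDE. Define $$A(t)=e^{\int_t^Ta(s)\,d\gamma(s)},\qquad \tilde\xi=\xi-\int_0^TA(s)G_s\,d\gamma(s).$$ Then for every $t\in[0,T]$ one has $\tilde\xi\in D^{\mathfrak c}_t$ and, almost surely, $$Y_t=A(t)^{-1}\,\widetilde E^{\mathfrak c}[\tilde\xi\mid\mathcal F^X_t]+A(t)^{-1}\int_0^tA(s)G_s\,d\gamma(s).$$ In particular $Y$ is unique: if $(Y',Z',\mathcal H')$ is another mild solution with the same $X,a,\gamma,\mathfrak c,G,\xi$, then $Y'_t=Y_t$ almost surely for every $t\in[0,T]$. -/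

import Mathlib

open MeasureTheory ProbabilityTheory
open scoped ENNReal

noncomputable section

namespace GaussianBSDE

/-- The time interval `[0, T]`. -/
abbrev Time (T : ℝ) : Type := Set.Icc (0 : ℝ) T

instance (T : ℝ) : CompactIccSpace (Time T) := ⟨fun {_ _} => isClosed_Icc.isCompact⟩

/-- A measurable centered Gaussian process `X = (X_t)_{t ∈ [0,T]}` with `X_0 = 0`. -/
structure CenteredGaussianProcess {Ω : Type*} [MeasurableSpace Ω] (P : Measure Ω) (T : ℝ) where
  toFun : Time T → Ω → ℝ
  pos : 0 < T
  measurable : Measurable (Function.uncurry toFun)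
  gaussian : IsGaussianProcess toFun P
  centered : ∀ t, ∫ ω, toFun t ω ∂P = 0
  zero : ∀ t : Time T, (t : ℝ) = 0 → toFun t =ᵐ[P] 0

/-- The Wick exponential `exp (f - E[f²] / 2)` of an element `f` of the first chaos. -/
def wickExp {Ω : Type*} [MeasurableSpace Ω] {P : Measure Ω} (f : Lp ℝ 2 P) : Ω → ℝ :=
  fun ω => Real.exp (f ω - (∫ ω', (f ω') ^ 2 ∂P) / 2)

namespace CenteredGaussianProcess

variable {Ω : Type*} [mΩ : MeasurableSpace Ω] {P : Measure Ω} {T : ℝ}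

/-- The time point `0`. -/
def start (X : CenteredGaussianProcess P T) : Time T := ⟨0, le_rfl, X.pos.le⟩

/-- The time point `T`. -/
def finish (X : CenteredGaussianProcess P T) : Time T := ⟨T, X.pos.le, le_rfl⟩

/-- The σ-field `F_t^X` generated by `X_s`, `s ≤ t`. -/
@[reducible] def F (X : CenteredGaussianProcess P T) (t : Time T) : MeasurableSpace Ω :=
  ⨆ s : {s : Time T // s ≤ t}, MeasurableSpace.comap (X.toFun s.1) inferInstance

/-- `ξ` belongs to `L²(Ω, F_T^X, P; E)`; for `E = ℝ` this is the space `L²_X`, and for a Hilbert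
space `E` it is `L²(Ω, E) = L²_X ⊗ E`. Random variables are represented by functions, and
measurability with respect to `F_T^X` is understood up to `P`-null sets. -/
def MemL2 {E : Type*} [NormedAddCommGroup E] (X : CenteredGaussianProcess P T) (ξ : Ω → E) : Prop :=
  AEStronglyMeasurable[X.F X.finish] ξ P ∧ MemLp ξ 2 P

/-- `Y` is a measurable process, adapted to the filtration generated by `X`
(up to `P`-null sets). -/
structure IsAdaptedMeasurable (X : CenteredGaussianProcess P T) (Y : Time T → Ω → ℝ) : Prop where
  measurable : Measurable (Function.uncurry Y)
  adapted : ∀ t, AEStronglyMeasurable[X.F t] (Y t) P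

/-- The covariance function `R(t, s) = E[X_t X_s]`. -/
def cov (X : CenteredGaussianProcess P T) (t s : Time T) : ℝ :=
  ∫ ω, X.toFun t ω * X.toFun s ω ∂P

theorem memLp (X : CenteredGaussianProcess P T) (t : Time T) : MemLp (X.toFun t) 2 P :=
  (X.gaussian.hasGaussianLaw_eval t).memLp_two

/-- `X_t` as an element of `L²(P)`. -/
def toL2 (X : CenteredGaussianProcess P T) (t : Time T) : Lp ℝ 2 P := (X.memLp t).toLp (X.toFun t)

theorem inner_toL2 (X : CenteredGaussianProcess P T) (t s : Time T) :
    inner ℝ (X.toL2 t) (X.toL2 s) = X.cov t s := by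
  rw [L2.inner_def, cov]
  refine integral_congr_ae ?_
  filter_upwards [(X.memLp t).coeFn_toLp, (X.memLp s).coeFn_toLp] with ω h1 h2
  simp only [toL2, h1, h2]
  simp [mul_comm]

/-! ### The space of deterministic integrands -/

/-- The linear span of the indicator functions `1_{(0,t]}`, `t ∈ [0,T]`: the finitely supported
family `α` stands for the step function `∑ t, α t • 1_{(0,t]}`. (The function `1_{(0,0]} = 0` is
represented by an element of seminorm zero, which the completion below identifies with `0`.) -/
def StepFun (_ : CenteredGaussianProcess P T) : Type := Time T →₀ ℝ

instance (X : CenteredGaussianProcess P T) : AddCommGroup X.StepFun :=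
  inferInstanceAs (AddCommGroup (Time T →₀ ℝ))

instance (X : CenteredGaussianProcess P T) : Module ℝ X.StepFun :=
  inferInstanceAs (Module ℝ (Time T →₀ ℝ))

/-- The map `∑ t, α t • 1_{(0,t]} ↦ ∑ t, α t • X_t`. -/
def stepIntegral (X : CenteredGaussianProcess P T) : X.StepFun →ₗ[ℝ] Lp ℝ 2 P :=
  Finsupp.linearCombination ℝ X.toL2

/-- The inner product on step functions with `⟪1_{(0,t]}, 1_{(0,s]}⟫ = R(t, s)`. -/
def stepInner (X : CenteredGaussianProcess P T) (f g : X.StepFun) : ℝ :=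
  Finsupp.sum f fun t x => Finsupp.sum g fun s y => x * y * X.cov t s

theorem stepInner_eq (X : CenteredGaussianProcess P T) (f g : X.StepFun) :
    X.stepInner f g = inner ℝ (X.stepIntegral f) (X.stepIntegral g) := by
  have key : ∀ f : X.StepFun, X.stepIntegral f = Finsupp.sum f fun t x => x • X.toL2 t :=
    fun f => Finsupp.linearCombination_apply ℝ f
  rw [key, key]
  simp only [stepInner, Finsupp.sum, sum_inner, inner_sum, real_inner_smul_left,
    real_inner_smul_right, inner_toL2]
  rw [Finset.sum_comm]
  exact Finset.sum_congr rfl fun s _ => Finset.sum_congr rfl fun t _ => by ring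

/-- The form `stepInner` is a positive semidefinite inner product. -/
@[reducible] def stepCore (X : CenteredGaussianProcess P T) :
    PreInnerProductSpace.Core ℝ X.StepFun where
  inner := X.stepInner
  conj_inner_symm f g := by
    change X.stepInner g f = X.stepInner f g
    rw [stepInner_eq, stepInner_eq, real_inner_comm]
  re_inner_nonneg f := by
    change 0 ≤ X.stepInner f f
    rw [stepInner_eq]; exact real_inner_self_nonneg
  add_left f g h := by
    change X.stepInner (f + g) h = X.stepInner f h + X.stepInner g h
    simp only [stepInner_eq, map_add, inner_add_left]
  smul_left f g r := by
    change X.stepInner (r • f) g = r * X.stepInner f g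
    simp only [stepInner_eq, map_smul, real_inner_smul_left]

instance (X : CenteredGaussianProcess P T) : SeminormedAddCommGroup X.StepFun :=
  InnerProductSpace.Core.toSeminormedAddCommGroup (𝕜 := ℝ) (c := X.stepCore)

instance (X : CenteredGaussianProcess P T) : InnerProductSpace ℝ X.StepFun :=
  InnerProductSpace.ofCore X.stepCore

/-- The Hilbert space of deterministic integrands associated to `X`: the closure (completion) of
the span of the indicator functions `1_{(0,t]}` for the inner product
`⟪1_{(0,t]}, 1_{(0,s]}⟫ = R(t, s)`. -/
abbrev Integrands (X : CenteredGaussianProcess P T) : Type := UniformSpace.Completion X.StepFun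

/-- The indicator function `1_{(0,t]}` as an element of the space of deterministic integrands. -/
def indic (X : CenteredGaussianProcess P T) (t : Time T) : X.Integrands :=
  ((show X.StepFun from Finsupp.single t 1 : X.StepFun) : UniformSpace.Completion X.StepFun)

theorem norm_stepIntegral (X : CenteredGaussianProcess P T) (f : X.StepFun) :
    ‖X.stepIntegral f‖ = ‖f‖ := by
  rw [norm_eq_sqrt_real_inner (X.stepIntegral f), norm_eq_sqrt_real_inner f, ← stepInner_eq]
  rfl

/-- The Wiener integral `I`, the isometry from the space of deterministic integrands onto the first
chaos that extends `1_{(0,t]} ↦ X_t`. -/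
def wiener (X : CenteredGaussianProcess P T) : X.Integrands →L[ℝ] Lp ℝ 2 P :=
  (LinearIsometry.toContinuousLinearMap ⟨X.stepIntegral, X.norm_stepIntegral⟩).extend
    (UniformSpace.Completion.toComplL (𝕜 := ℝ) (E := X.StepFun))

/-- The element `t ↦ E[X_t I(h)]` of the Cameron-Martin space that corresponds to `h`. The
Cameron-Martin space consists of all these functions, with the Hilbert space structure transported
from the space of deterministic integrands. -/
def cameronMartin (X : CenteredGaussianProcess P T) (h : X.Integrands) : Time T → ℝ :=
  fun t => ∫ ω, X.toFun t ω * X.wiener h ω ∂P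

/-- The `S`-transform `(Sξ)(h) = E[ξ exp^⋄(I(h))]`, for real or vector valued `ξ`. -/
def S {E : Type*} [NormedAddCommGroup E] [NormedSpace ℝ E] (X : CenteredGaussianProcess P T)
    (ξ : Ω → E) (h : X.Integrands) : E :=
  ∫ ω, wickExp (X.wiener h) ω • ξ ω ∂P

end CenteredGaussianProcess

/-! ### Abstract spaces of integrands

A Hilbert space `H` that contains the (classes of the) indicator functions `1_{(0,t]}` is given by
the map `ind : [0,T] → H`, `t ↦ 1_{(0,t]}`. The functions `1_{(0,t]}`, `0 < t ≤ T`, are linearly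
independent, so that `1_{(0,0]} = 0` is the only linear relation that `ind` has to respect. -/

section Hilbert

variable {T : ℝ} {H : Type*} [NormedAddCommGroup H] [InnerProductSpace ℝ H]

/-- `ind` extends to a linear map on step functions, and its range is total in `H`. -/
structure IsIndicatorSystem (ind : Time T → H) : Prop where
  zero : ∀ t : Time T, (t : ℝ) = 0 → ind t = 0
  total : (Submodule.span ℝ (Set.range ind)).topologicalClosure = ⊤

/-- `H` is a space of integrands for the integrator `g`. -/
def IsSpaceOfIntegrands (ind : Time T → H) (g : Time T → ℝ) : Prop :=
  IsIndicatorSystem ind ∧ ∃ L : H →L[ℝ] ℝ, ∀ t, L (ind t) = g t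

open Classical in
/-- The integral `∫_0^T · d^H g`, the continuous linear extension of `1_{(0,t]} ↦ g t`
(and `0` if there is none). -/
def detIntegral (ind : Time T → H) (g : Time T → ℝ) : H →L[ℝ] ℝ :=
  if h : ∃ L : H →L[ℝ] ℝ, ∀ t, L (ind t) = g t then h.choose else 0

/-- The truncation condition: for every `r` there is a continuous linear operator on `H` that maps
`1_{(0,t]}` to `1_{(0,t ∧ r]}`. -/
def HasTruncation (ind : Time T → H) : Prop :=
  ∀ r : Time T, ∃ J : H →L[ℝ] H, ∀ t, J (ind t) = ind (min t r)

open Classical in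
/-- The truncation operator `I_r`, the continuous linear extension of `1_{(0,t]} ↦ 1_{(0,t ∧ r]}`
(and `0` if there is none). -/
def trunc (ind : Time T → H) (r : Time T) : H →L[ℝ] H :=
  if h : ∃ J : H →L[ℝ] H, ∀ t, J (ind t) = ind (min t r) then h.choose else 0

/-- The operator `I_{(u,v]} = I_v - I_u`. -/
def truncIoc (ind : Time T → H) (u v : Time T) : H →L[ℝ] H := trunc ind v - trunc ind u

end Hilbert

namespace CenteredGaussianProcess

variable {Ω : Type*} [mΩ : MeasurableSpace Ω] {P : Measure Ω} {T : ℝ}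

section Skorokhod

variable {H : Type*} [NormedAddCommGroup H] [InnerProductSpace ℝ H]

/-- The set of all `h` such that `H` is a space of integrands for the element of the
Cameron-Martin space that corresponds to `h`. -/
def goodIntegrators (X : CenteredGaussianProcess P T) (ind : Time T → H) : Set X.Integrands :=
  {h | IsSpaceOfIntegrands ind (X.cameronMartin h)}

/-- `H` is appropriate for the extension of the Skorokhod integral with respect to `X`: it is a
space of integrands for a dense set of elements of the Cameron-Martin space. -/
def IsAppropriate (X : CenteredGaussianProcess P T) (ind : Time T → H) : Prop :=
  Dense (X.goodIntegrators ind)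

/-- `ζ` is the `H`-Skorokhod integral `∫_0^T Z d^⋄X`. -/
def IsSkorokhodIntegral (X : CenteredGaussianProcess P T) (ind : Time T → H) (Z : Ω → H)
    (ζ : Ω → ℝ) : Prop :=
  X.MemL2 ζ ∧ ∀ h ∈ X.goodIntegrators ind,
    X.S ζ h = detIntegral ind (X.cameronMartin h) (X.S Z h)

/-- `ζ` is the `H`-Skorokhod integral `∫_u^v Z d^⋄X`. -/
def IsSkorokhodIntegralIoc (X : CenteredGaussianProcess P T) (ind : Time T → H) (Z : Ω → H)
    (u v : Time T) (ζ : Ω → ℝ) : Prop :=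
  X.IsSkorokhodIntegral ind (fun ω => truncIoc ind u v (Z ω)) ζ

end Skorokhod

/-- `X` has an indefinite Wiener integral. -/
def HasIndefiniteWienerIntegral (X : CenteredGaussianProcess P T) : Prop :=
  HasTruncation X.indic

/-! ### Shifted quasi-conditional expectation -/

/-- The element `h^r = I_r^* h`. -/
def dualTrunc (X : CenteredGaussianProcess P T) (r : Time T) (h : X.Integrands) : X.Integrands :=
  ContinuousLinearMap.adjoint (trunc X.indic r) h

/-- `η` is a `c`-shifted quasi-conditional expectation of `ξ` given `F_r^X`. -/
def IsQuasiCondExp (X : CenteredGaussianProcess P T) (c : X.Integrands) (r : Time T)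
    (ξ η : Ω → ℝ) : Prop :=
  X.MemL2 η ∧ ∀ h : X.Integrands, X.S ξ (X.dualTrunc r (h + c) - c) = X.S η h

/-- The domain `D_r^c` of the `c`-shifted quasi-conditional expectation. -/
def quasiDomain (X : CenteredGaussianProcess P T) (c : X.Integrands) (r : Time T) : Set (Ω → ℝ) :=
  {ξ | X.MemL2 ξ ∧ ∃ η, X.IsQuasiCondExp c r ξ η}

open Classical in
/-- The `c`-shifted quasi-conditional expectation of `ξ` given `F_r^X`, which is determined
`P`-almost surely (and `0` outside the domain). -/
def quasiCondExp (X : CenteredGaussianProcess P T) (c : X.Integrands) (r : Time T) (ξ : Ω → ℝ) :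
    Ω → ℝ :=
  if h : ∃ η, X.IsQuasiCondExp c r ξ η then h.choose else 0

/-! ### Linear BSDEs -/

/-- `E[(∫_0^T |Y_s| d|γ|(s))²] < ∞`, where `|γ|` is the total variation measure of `dγ`. -/
def SquareIntegrable (_ : CenteredGaussianProcess P T) {γ : Time T → ℝ}
    (hγ : BoundedVariationOn γ Set.univ) (Y : Time T → Ω → ℝ) : Prop :=
  ∫⁻ ω, (∫⁻ s, ‖Y s ω‖ₑ ∂hγ.vectorMeasure.variation) ^ 2 ∂P < ∞

/-- `(Y, Z, H)` is a mild solution of the linear BSDE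
`dY = (a Y + G) dγ + Z dc + Z d^⋄X`, `Y_T = ξ`, where the driving Cameron-Martin function is the one
that corresponds to `c`. -/
structure IsMildSolution (X : CenteredGaussianProcess P T) {γ : Time T → ℝ}
    (hγ : BoundedVariationOn γ Set.univ) (a : Time T → ℝ) (G : Time T → Ω → ℝ)
    (c : X.Integrands) (ξ : Ω → ℝ)
    {H : Type*} [NormedAddCommGroup H] [InnerProductSpace ℝ H] (ind : Time T → H)
    (Y : Time T → Ω → ℝ) (Z : Ω → H) : Prop where
  appropriate : X.IsAppropriate ind
  hasTruncation : HasTruncation ind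
  spaceOfIntegrands : IsSpaceOfIntegrands ind (X.cameronMartin c)
  adapted : X.IsAdaptedMeasurable Y
  memL2 : ∀ t, X.MemL2 (Y t)
  squareIntegrable : X.SquareIntegrable hγ fun s ω => a s * Y s ω
  memL2_Z : X.MemL2 Z
  exists_integral : ∀ t, ∃ ζ, X.IsSkorokhodIntegralIoc ind Z t X.finish ζ
  equation : ∀ t ζ, X.IsSkorokhodIntegralIoc ind Z t X.finish ζ → ∀ᵐ ω ∂P,
    Y t ω = ξ ω
      - (∫ᵛ s in Set.Ioc t X.finish, (a s * Y s ω + G s ω) ∂•hγ.vectorMeasure)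
      - detIntegral ind (X.cameronMartin c) (truncIoc ind t X.finish (Z ω))
      - ζ ω

/-- `A(t) = exp (∫_t^T a dγ)`. -/
def expFactor (X : CenteredGaussianProcess P T) {γ : Time T → ℝ}
    (hγ : BoundedVariationOn γ Set.univ) (a : Time T → ℝ) (t : Time T) : ℝ :=
  Real.exp (∫ᵛ s in Set.Ioc t X.finish, a s ∂•hγ.vectorMeasure)

/-- `∫_0^t A(s) G_s dγ(s)`. -/
def weightedIntegral (X : CenteredGaussianProcess P T) {γ : Time T → ℝ}
    (hγ : BoundedVariationOn γ Set.univ) (a : Time T → ℝ) (G : Time T → Ω → ℝ) (t : Time T) :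
    Ω → ℝ :=
  fun ω => ∫ᵛ s in Set.Ioc X.start t, X.expFactor hγ a s * G s ω ∂•hγ.vectorMeasure

/-- The modified terminal value `ξ - ∫_0^T A(s) G_s dγ(s)`. -/
def modifiedTerminal (X : CenteredGaussianProcess P T) {γ : Time T → ℝ}
    (hγ : BoundedVariationOn γ Set.univ) (a : Time T → ℝ) (G : Time T → Ω → ℝ) (ξ : Ω → ℝ) :
    Ω → ℝ :=
  fun ω => ξ ω - X.weightedIntegral hγ a G X.finish ω

end CenteredGaussianProcess

end GaussianBSDE

end

noncomputable section

namespace GaussianBSDE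

/-! ### Integration against a signed measure -/

section SignedMeasure

variable {α : Type*} [MeasurableSpace α]

/-! Fix a time `u` and an integrand `h` for which `H` is a space of integrands, and evaluate the
BSDE under the `S`-transform at `g = (h + c)^u - c`. The Cameron-Martin function of `g` is that of
`h + c` stopped at `u`, minus that of `c`. Hence the integrator `c + g` is constant after `u`, and
for `t ≥ u` the integral of `Z` against `c` cancels the `S`-transform of its Skorokhod integral
(`detIntegral_truncIoc_add_shift`). What remains is a scalar backward linear equation on `[u, T]`
for `t ↦ S(Y_t)(g)` (`IsMildSolution.S_equation`), solved by variation of constants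
(`exp_mul_eq_of_integral_equation`).

At time `u` both `Y_u` and `∫_0^u A G dγ` are `F_u`-measurable, and `g` and `h` have the same
Cameron-Martin function on `[0, u]`, so `g` may be replaced by `h` there (`S_eq_of_adapted`). This
gives `S(ξ̃)(g) = S(A(u) Y_u - ∫_0^u A G dγ)(h)`, first for `h` in a dense set and then for all `h`,
since `S`-transforms are continuous. That is the defining identity of the quasi-conditional
expectation. Injectivity of the `S`-transform (`eq_of_S_eq`) makes it unique; the resulting formula
for `Y` involves neither `Z` nor `H`, whence uniqueness of `Y`.

Two analytic supports: `dγ` is written as a sign density times its finite, atomless variation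
measure, so that Fubini applies; and exponentials of finite linear combinations of the `X_s`, `s ≤
u`, determine conditional expectations given `F_u`. -/

instance isFiniteMeasure_variation (ν : SignedMeasure α) : IsFiniteMeasure ν.variation := by
  rw [← SignedMeasure.totalVariation_eq_variation]
  unfold SignedMeasure.totalVariation
  infer_instance

/-- A signed measure has a density of modulus one with respect to its total variation. -/
theorem exists_sign_density (ν : SignedMeasure α) :
    ∃ σ : α → ℝ, Measurable σ ∧ (∀ x, |σ x| = 1) ∧
      ∀ s, MeasurableSet s → ν s = ∫ x in s, σ x ∂ν.variation := by
  classical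
  obtain ⟨i, hi, hpos, hneg, hp, hn⟩ := ν.toJordanDecomposition_spec
  have hm : Measurable (i.indicator (fun _ => (1 : ℝ)) - iᶜ.indicator fun _ => (1 : ℝ)) :=
    (measurable_const.indicator hi).sub (measurable_const.indicator hi.compl)
  -- `i` is the positive set of a Hahn decomposition, so the density is `1` on `i` and `-1` off it.
  refine ⟨i.indicator (fun _ => (1 : ℝ)) - iᶜ.indicator fun _ => (1 : ℝ), hm, fun x => ?_,
    fun s hs => ?_⟩
  · by_cases hx : x ∈ i <;> simp [hx]
  · have hint : ∀ t : Set α, MeasurableSet t →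
        Integrable (t.indicator fun _ => (1 : ℝ)) (ν.variation.restrict s) :=
      fun t ht => (integrable_const 1).indicator ht
    have hv : ∀ t, ν.variation.real t = ν.toJordanDecomposition.posPart.real t
        + ν.toJordanDecomposition.negPart.real t := fun t => by
      rw [← SignedMeasure.totalVariation_eq_variation, SignedMeasure.totalVariation,
        measureReal_add_apply]
    have e1 : ν.toJordanDecomposition.posPart.real (i ∩ s)
        = ν.toJordanDecomposition.posPart.real s := by
      simp only [measureReal_def]
      rw [hp, SignedMeasure.toMeasureOfZeroLE_apply _ _ _ (hi.inter hs),
        SignedMeasure.toMeasureOfZeroLE_apply _ _ _ hs]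
      simp [← Set.inter_assoc]
    have e2 : ν.toJordanDecomposition.posPart.real (iᶜ ∩ s) = 0 := by
      simp only [measureReal_def]
      rw [hp, SignedMeasure.toMeasureOfZeroLE_apply _ _ _ (hi.compl.inter hs)]
      simp [← Set.inter_assoc]
    have e3 : ν.toJordanDecomposition.negPart.real (iᶜ ∩ s)
        = ν.toJordanDecomposition.negPart.real s := by
      simp only [measureReal_def]
      rw [hn, SignedMeasure.toMeasureOfLEZero_apply _ _ _ (hi.compl.inter hs),
        SignedMeasure.toMeasureOfLEZero_apply _ _ _ hs]
      simp [← Set.inter_assoc]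
    have e4 : ν.toJordanDecomposition.negPart.real (i ∩ s) = 0 := by
      simp only [measureReal_def]
      rw [hn, SignedMeasure.toMeasureOfLEZero_apply _ _ _ (hi.inter hs)]
      simp [← Set.inter_assoc]
    simp only [Pi.sub_apply]
    rw [integral_sub (hint i hi) (hint _ hi.compl), integral_indicator hi,
      integral_indicator hi.compl, Measure.restrict_restrict hi, Measure.restrict_restrict hi.compl,
      setIntegral_const, setIntegral_const, hv, hv, e1, e2, e3, e4,
      SignedMeasure.apply_eq_posPart_real_sub_negPart_real _ hs]
    simp

/-- Both sides are additive and continuous in `f` for the `L¹` norm of the variation, and they agree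
on multiples of indicators. -/
theorem integral_eq_integral_density {ν : SignedMeasure α} {σ : α → ℝ} (hσ : Measurable σ)
    (h1 : ∀ x, |σ x| = 1) (hν : ∀ s, MeasurableSet s → ν s = ∫ x in s, σ x ∂ν.variation)
    {f : α → ℝ} (hf : Integrable f ν.variation) :
    ∫ᵛ x, f x ∂•ν = ∫ x, f x * σ x ∂ν.variation := by
  have hb : ∀ {g : α → ℝ}, Integrable g ν.variation →
      Integrable (fun x => g x * σ x) ν.variation := fun hg =>
    hg.mul_bdd (c := 1) hσ.aestronglyMeasurable (ae_of_all _ fun x => by simp [h1])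
  have hcont : Continuous fun g : α →₁[ν.variation] ℝ => ∫ x, g x * σ x ∂ν.variation := by
    refine LipschitzWith.continuous (K := 1) (LipschitzWith.of_dist_le_mul fun g g' => ?_)
    have hg := L1.integrable_coeFn g
    have hg' := L1.integrable_coeFn g'
    rw [dist_eq_norm, dist_eq_norm, ← integral_sub (hb hg) (hb hg'), L1.norm_eq_integral_norm,
      NNReal.coe_one, one_mul]
    refine (norm_integral_le_integral_norm _).trans (le_of_eq (integral_congr_ae ?_))
    filter_upwards [Lp.coeFn_sub g g'] with x hx
    rw [hx, Pi.sub_apply, ← sub_mul, norm_mul, Real.norm_eq_abs (σ x), h1, mul_one]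
  refine Integrable.induction (fun f : α → ℝ =>
    ∫ᵛ x, f x ∂•ν = ∫ x, f x * σ x ∂ν.variation) ?_ ?_ ?_ ?_ hf
  · intro c s hs _
    rw [VectorMeasure.integral_indicator_const c hs]
    have : (fun x => s.indicator (fun _ => c) x * σ x) = s.indicator fun x => c * σ x := by
      ext x; by_cases hx : x ∈ s <;> simp [hx]
    rw [this, integral_indicator hs, integral_const_mul, ← hν s hs]
    simp
  · intro f g _ hf hg h1 h2
    simp only [Pi.add_apply, add_mul]
    rw [VectorMeasure.integral_fun_add hf hg, h1, h2, integral_add (hb hf) (hb hg)]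
  · exact isClosed_eq (VectorMeasure.continuous_integral) hcont
  · intro f g hfg hf h
    rw [← VectorMeasure.integral_congr_ae hfg, h]
    refine integral_congr_ae ?_
    filter_upwards [hfg] with x hx
    rw [hx]

theorem setIntegral_eq_setIntegral_density {ν : SignedMeasure α} {σ : α → ℝ} (hσ : Measurable σ)
    (h1 : ∀ x, |σ x| = 1) (hν : ∀ s, MeasurableSet s → ν s = ∫ x in s, σ x ∂ν.variation)
    {f : α → ℝ} (hf : Integrable f ν.variation) {s : Set α} (hs : MeasurableSet s) :
    ∫ᵛ x in s, f x ∂•ν = ∫ x in s, f x * σ x ∂ν.variation := by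
  rw [← VectorMeasure.integral_indicator hs,
    integral_eq_integral_density hσ h1 hν (hf.indicator hs), ← integral_indicator hs]
  congr with x
  by_cases hx : x ∈ s <;> simp [hx]

end SignedMeasure

/-- The mass of `{t}` is the jump of `γ` at `t`, which continuity excludes. -/
theorem nullSingletonClass_variation {T : ℝ} {γ : Time T → ℝ} (hγc : Continuous γ)
    (hγ : BoundedVariationOn γ Set.univ) : NullSingletonClass hγ.vectorMeasure.variation := by
  refine ⟨fun t => ?_⟩
  rw [VectorMeasure.variation_apply_eq_zero (measurableSet_singleton t)]
  intro s hst _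
  rcases Set.subset_singleton_iff_eq.1 hst with rfl | rfl
  · simp
  · rw [hγ.vectorMeasure_singleton, hγc.continuousAt.continuousWithinAt.rightLim_eq,
      hγc.continuousAt.continuousWithinAt.leftLim_eq,
      sub_self]

/-! ### A linear integral equation -/

section LinearEquation

set_option linter.unusedSectionVars false

variable {α : Type*} [LinearOrder α] [TopologicalSpace α] [OrderTopology α]
  [SecondCountableTopology α] [MeasurableSpace α] [BorelSpace α]
  {μ : Measure α} [IsFiniteMeasure μ]

theorem integral_Ioi_eq_integral_indicator (f : α → ℝ) (t : α) :
    ∫ s in Set.Ioi t, f s ∂μ = ∫ s, {p : α × α | p.1 < p.2}.indicator (fun p => f p.2) (t, s) ∂μ := by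
  rw [← integral_indicator measurableSet_Ioi]
  rfl

theorem aestronglyMeasurable_integral_Ioi {f : α → ℝ} (hf : AEStronglyMeasurable f μ) :
    AEStronglyMeasurable (fun t => ∫ s in Set.Ioi t, f s ∂μ) μ := by
  simp only [integral_Ioi_eq_integral_indicator]
  exact (AEStronglyMeasurable.indicator (μ := μ.prod μ) hf.comp_snd
    measurableSet_lt').integral_prod_right'

theorem measurable_integral_Ioi {f : α → ℝ} (hf : Measurable f) :
    Measurable (fun t => ∫ s in Set.Ioi t, f s ∂μ) := by
  simp only [integral_Ioi_eq_integral_indicator]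
  exact ((hf.comp measurable_snd).indicator
    measurableSet_lt').stronglyMeasurable.integral_prod_right'.measurable

theorem abs_integral_Ioi_le {f : α → ℝ} (hf : Integrable f μ) (t : α) :
    |∫ s in Set.Ioi t, f s ∂μ| ≤ ∫ s, |f s| ∂μ :=
  (norm_integral_le_integral_norm f).trans
    (setIntegral_le_integral hf.norm (ae_of_all _ fun _ => norm_nonneg _))

theorem integrable_mul_integral_Ioi {f g : α → ℝ} (hf : Integrable f μ) (hg : Integrable g μ) :
    Integrable (fun s => f s * ∫ r in Set.Ioi s, g r ∂μ) μ :=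
  hf.mul_bdd (c := ∫ s, |g s| ∂μ) (aestronglyMeasurable_integral_Ioi hg.1)
    (ae_of_all _ fun s => abs_integral_Ioi_le hg s)

/-- The product rule for functions that are absolutely continuous for an atomless measure. -/
theorem integral_mul_integral_Ioi [NullSingletonClass μ] {f g : α → ℝ} (hf : Integrable f μ)
    (hg : Integrable g μ) (t : α) :
    (∫ s in Set.Ioi t, f s ∂μ) * ∫ s in Set.Ioi t, g s ∂μ =
      ∫ s in Set.Ioi t, (f s * (∫ r in Set.Ioi s, g r ∂μ) +
        g s * ∫ r in Set.Ioi s, f r ∂μ) ∂μ := by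
  set m := μ.restrict (Set.Ioi t) with hm
  have hf' : Integrable f m := hf.restrict
  have hg' : Integrable g m := hg.restrict
  have hr : ∀ (f : α → ℝ) s, s ∈ Set.Ioi t →
      ∫ r in Set.Ioi s, f r ∂μ = ∫ r in Set.Ioi s, f r ∂m := by
    intro f s hs
    rw [hm, Measure.restrict_restrict measurableSet_Ioi,
      Set.inter_eq_left.2 (Set.Ioi_subset_Ioi (le_of_lt hs))]
  have hprod : Integrable (fun p : α × α => f p.1 * g p.2) (m.prod m) := hf'.mul_prod hg'
  have hlt : MeasurableSet {p : α × α | p.1 < p.2} := measurableSet_lt'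
  have hgt : MeasurableSet {p : α × α | p.2 < p.1} := measurable_swap measurableSet_lt'
  have hdec : ∀ᵐ p : α × α ∂m.prod m, f p.1 * g p.2
      = {p : α × α | p.1 < p.2}.indicator (fun p => f p.1 * g p.2) p
        + {p : α × α | p.2 < p.1}.indicator (fun p => f p.1 * g p.2) p := by
    -- Splitting the square into two triangles loses only the diagonal, which is null because `μ`
    -- has no atoms.
    have h0 : (m.prod m) {p : α × α | p.1 = p.2} = 0 := by
      rw [Measure.measure_prod_null (measurableSet_eq_fun measurable_fst measurable_snd)]
      refine ae_of_all _ fun x => ?_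
      have : Prod.mk x ⁻¹' {p : α × α | p.1 = p.2} = {x} := by ext y; simp [eq_comm]
      simp [this]
    filter_upwards [measure_eq_zero_iff_ae_notMem.1 h0] with p hp
    rcases lt_trichotomy p.1 p.2 with h | h | h
    · simp [h, h.not_gt]
    · exact absurd h hp
    · simp [h, h.not_gt]
  have i1 := hprod.indicator hlt
  have i2 := hprod.indicator hgt
  rw [← integral_prod_mul, integral_congr_ae hdec, integral_add i1 i2, integral_prod _ i1,
    integral_prod_symm _ i2, integral_add]
  · congr 1
    · refine setIntegral_congr_fun measurableSet_Ioi fun s hs => ?_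
      rw [hr g s hs, ← integral_const_mul,
        ← integral_indicator (μ := m) (s := Set.Ioi s) measurableSet_Ioi]
      rfl
    · refine setIntegral_congr_fun measurableSet_Ioi fun s hs => ?_
      rw [hr f s hs, ← integral_const_mul,
        ← integral_indicator (μ := m) (s := Set.Ioi s) measurableSet_Ioi]
      refine integral_congr_ae (ae_of_all _ fun x => ?_)
      by_cases hx : s < x <;> simp [hx, mul_comm]
  · exact (integrable_mul_integral_Ioi hf hg).restrict
  · exact (integrable_mul_integral_Ioi hg hf).restrict

theorem integrable_mul_integral_Ioi_pow {f a : α → ℝ} (hf : Integrable f μ) (ha : Integrable a μ)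
    (n : ℕ) : Integrable (fun s => f s * (∫ r in Set.Ioi s, a r ∂μ) ^ n) μ :=
  hf.mul_bdd (c := (∫ s, |a s| ∂μ) ^ n) ((aestronglyMeasurable_integral_Ioi ha.1).pow n)
    (ae_of_all _ fun s => by
      rw [norm_pow]
      exact pow_le_pow_left₀ (norm_nonneg _) (abs_integral_Ioi_le ha s) n)

/-- Induction through the product rule, standing in for the chain rule: the tail integral need not
be differentiable in any classical sense. -/
theorem integral_Ioi_pow_succ [NullSingletonClass μ] {a : α → ℝ} (ha : Integrable a μ) (n : ℕ)
    (t : α) : (∫ s in Set.Ioi t, a s ∂μ) ^ (n + 1) =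
      (n + 1) * ∫ s in Set.Ioi t, a s * (∫ r in Set.Ioi s, a r ∂μ) ^ n ∂μ := by
  induction n generalizing t with
  | zero => simp
  | succ n ih =>
    have hi := (integrable_mul_integral_Ioi_pow ha ha n).const_mul ((n : ℝ) + 1)
    rw [pow_succ', ih, ← integral_const_mul, integral_mul_integral_Ioi ha hi,
      ← integral_const_mul]
    refine integral_congr_ae (ae_of_all _ fun s => ?_)
    simp only
    rw [integral_const_mul, ← ih]
    push_cast
    ring

theorem integrable_mul_exp_integral_Ioi {f a : α → ℝ} (hf : Integrable f μ)
    (ha : Integrable a μ) :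
    Integrable (fun s => f s * Real.exp (∫ r in Set.Ioi s, a r ∂μ)) μ :=
  hf.mul_bdd (c := Real.exp (∫ s, |a s| ∂μ))
    (Real.continuous_exp.comp_aestronglyMeasurable (aestronglyMeasurable_integral_Ioi ha.1))
    (ae_of_all _ fun s => by
      rw [Real.norm_eq_abs, Real.abs_exp]
      exact Real.exp_le_exp.2 ((le_abs_self _).trans (abs_integral_Ioi_le ha s)))

/-- Sum the power formula over the exponential series; the bound `C = ∫ |a|` on all tail integrals
justifies exchanging sum and integral. -/
theorem exp_integral_Ioi [NullSingletonClass μ] {a : α → ℝ} (ha : Integrable a μ) (t : α) :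
    Real.exp (∫ s in Set.Ioi t, a s ∂μ) =
      1 + ∫ s in Set.Ioi t, a s * Real.exp (∫ r in Set.Ioi s, a r ∂μ) ∂μ := by
  have hexp : ∀ x : ℝ, HasSum (fun n : ℕ => x ^ n / n.factorial) (Real.exp x) := fun x => by
    rw [Real.exp_eq_exp_ℝ]; exact NormedSpace.expSeries_div_hasSum_exp x
  set C := ∫ s, |a s| ∂μ
  have h1 : HasSum (fun n : ℕ => ∫ s in Set.Ioi t,
      a s * ((∫ r in Set.Ioi s, a r ∂μ) ^ n / n.factorial) ∂μ)
      (∫ s in Set.Ioi t, a s * Real.exp (∫ r in Set.Ioi s, a r ∂μ) ∂μ) := by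
    refine hasSum_integral_of_dominated_convergence
      (bound := fun n s => |a s| * (C ^ n / n.factorial)) ?_ ?_ ?_ ?_ ?_
    · intro n
      have := ((integrable_mul_integral_Ioi_pow ha ha n).div_const (n.factorial : ℝ)).1.restrict
        (s := Set.Ioi t)
      simpa only [mul_div_assoc] using this
    · refine fun n => ae_of_all _ fun s => ?_
      rw [norm_mul, Real.norm_eq_abs, norm_div, norm_pow, Real.norm_natCast]
      gcongr
      exact abs_integral_Ioi_le ha s
    · exact ae_of_all _ fun s => ((hexp C).summable.mul_left _)
    · simp only [tsum_mul_left]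
      exact ha.restrict.abs.mul_const _
    · exact ae_of_all _ fun s => (hexp _).mul_left _
  have h2 := hexp (∫ s in Set.Ioi t, a s ∂μ)
  -- Dropping the constant term aligns the power `n + 1` here with the `n`-th term of `h1`.
  rw [← hasSum_nat_add_iff' 1] at h2
  simp only [Finset.range_one, Finset.sum_singleton, pow_zero, Nat.factorial_zero, Nat.cast_one,
    div_one] at h2
  have h3 : (fun n : ℕ => (∫ s in Set.Ioi t, a s ∂μ) ^ (n + 1) / ((n + 1).factorial : ℝ)) =
      fun n : ℕ => ∫ s in Set.Ioi t,
        a s * ((∫ r in Set.Ioi s, a r ∂μ) ^ n / n.factorial) ∂μ := by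
    ext n
    simp only [← mul_div_assoc]
    rw [integral_div, integral_Ioi_pow_succ ha, Nat.factorial_succ]
    push_cast
    field_simp
  rw [h3] at h2
  rw [← h2.unique h1]
  ring

/-- Variation of constants for the backward equation `dy = (a y + k) dμ`. -/
theorem exp_mul_eq_of_integral_equation [NullSingletonClass μ] {a k y : α → ℝ} {x : ℝ} {u : α}
    (ha : Integrable a μ) (hk : Integrable k μ) (hay : Integrable (fun s => a s * y s) μ)
    (hy : ∀ t, u ≤ t → y t = x - ∫ s in Set.Ioi t, (a s * y s + k s) ∂μ) :
    Real.exp (∫ s in Set.Ioi u, a s ∂μ) * y u =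
      x - ∫ s in Set.Ioi u, Real.exp (∫ r in Set.Ioi s, a r ∂μ) * k s ∂μ := by
  set A : α → ℝ := fun t => Real.exp (∫ s in Set.Ioi t, a s ∂μ) with hA
  have hA1 : ∀ t, ∫ s in Set.Ioi t, a s * A s ∂μ = A t - 1 := fun t => by
    rw [eq_sub_iff_add_eq', hA]; exact (exp_integral_Ioi ha t).symm
  have iaA : Integrable (fun s => a s * A s) μ := integrable_mul_exp_integral_Ioi ha ha
  have iG : Integrable (fun s => a s * y s + k s) μ := hay.add hk
  have iGA : Integrable (fun s => (a s * y s + k s) * A s) μ :=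
    integrable_mul_exp_integral_Ioi iG ha
  have ikA : Integrable (fun s => k s * A s) μ := integrable_mul_exp_integral_Ioi hk ha
  -- The product rule for `(A - 1) (x - y)`, both factors being tail integrals; the terms `a A y`
  -- cancel.
  have key := integral_mul_integral_Ioi iaA iG u
  have hcongr : ∫ s in Set.Ioi u, (a s * A s * (∫ r in Set.Ioi s, (a r * y r + k r) ∂μ) +
      (a s * y s + k s) * ∫ r in Set.Ioi s, a r * A r ∂μ) ∂μ =
      ∫ s in Set.Ioi u, (x * (a s * A s) + k s * A s - (a s * y s + k s)) ∂μ := by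
    refine setIntegral_congr_fun measurableSet_Ioi fun s hs => ?_
    have h1 := hy s (le_of_lt hs)
    rw [hA1, show ∫ r in Set.Ioi s, (a r * y r + k r) ∂μ = x - y s by rw [h1]; ring]
    ring
  rw [hcongr, integral_sub _ iG.restrict, integral_add (iaA.const_mul x).restrict ikA.restrict,
    integral_const_mul, hA1] at key
  · rw [show (fun s => A s * k s) = fun s => k s * A s from funext fun s => mul_comm _ _]
    have h1 := hy u le_rfl
    have h2 : ∫ s in Set.Ioi u, (a s * y s + k s) ∂μ = x - y u := by rw [h1]; ring
    rw [h2] at key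
    linear_combination -key
  · exact ((iaA.const_mul x).add ikA).restrict

end LinearEquation

/-! ### Exponentials of linear combinations determine a conditional expectation -/

section Totality

variable {Ω : Type*} [mΩ : MeasurableSpace Ω] {P : Measure Ω}

/-- The positive and negative parts of `D` give finite measures under which `V` has the same
everywhere finite moment generating function. Analytic continuation makes the complex ones agree,
and these determine the image measures. -/
theorem map_withDensity_eq_of_exp {V D : Ω → ℝ} (hV : Measurable V) (hD : Integrable D P)
    (hint : ∀ r : ℝ, Integrable (fun ω => Real.exp (r * V ω) * D ω) P)
    (h0 : ∀ r : ℝ, ∫ ω, Real.exp (r * V ω) * D ω ∂P = 0) :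
    (P.withDensity fun ω => ENNReal.ofReal (D ω)).map V =
      (P.withDensity fun ω => ENNReal.ofReal (-D ω)).map V := by
  have main : ∀ E : Ω → ℝ, Integrable E P →
      (∀ r : ℝ, Integrable (fun ω => Real.exp (r * V ω) * E ω) P) →
      integrableExpSet V (P.withDensity fun ω => ENNReal.ofReal (E ω)) = Set.univ ∧
      ∀ r : ℝ, mgf V (P.withDensity fun ω => ENNReal.ofReal (E ω)) r =
        ∫ ω, max (E ω) 0 * Real.exp (r * V ω) ∂P ∧
        Integrable (fun ω => max (E ω) 0 * Real.exp (r * V ω)) P := by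
    intro E hE hEi
    have hm : AEMeasurable (fun ω => ENNReal.ofReal (E ω)) P := hE.1.aemeasurable.ennreal_ofReal
    have hi : ∀ r : ℝ, Integrable (fun ω => max (E ω) 0 * Real.exp (r * V ω)) P := fun r => by
      refine ((hEi r).pos_part).congr (ae_of_all _ fun ω => ?_)
      simp only
      rw [mul_comm, max_mul_of_nonneg _ _ (Real.exp_pos _).le, zero_mul]
    refine ⟨Set.eq_univ_of_forall fun r => ?_, fun r => ⟨?_, hi r⟩⟩
    · rw [integrableExpSet, Set.mem_ofPred_eq,
        integrable_withDensity_iff_integrable_smul₀' hm (ae_of_all _ fun _ => ENNReal.ofReal_lt_top)]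
      simpa [ENNReal.toReal_ofReal'] using hi r
    · rw [mgf, integral_withDensity_eq_integral_toReal_smul₀ hm
        (ae_of_all _ fun _ => ENNReal.ofReal_lt_top)]
      simp [ENNReal.toReal_ofReal']
  obtain ⟨u1, m1⟩ := main D hD hint
  obtain ⟨-, m2⟩ := main (fun ω => -D ω) hD.neg fun r => by simpa using (hint r).neg
  have : IsFiniteMeasure (P.withDensity fun ω => ENNReal.ofReal (D ω)) :=
    isFiniteMeasure_withDensity_ofReal hD.2
  have : IsFiniteMeasure (P.withDensity fun ω => ENNReal.ofReal (-D ω)) :=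
    isFiniteMeasure_withDensity_ofReal hD.neg.2
  have hmgf : mgf V (P.withDensity fun ω => ENNReal.ofReal (D ω)) =
      mgf V (P.withDensity fun ω => ENNReal.ofReal (-D ω)) := by
    ext r
    rw [(m1 r).1, (m2 r).1, ← sub_eq_zero, ← integral_sub (m1 r).2 (m2 r).2]
    refine Eq.trans (integral_congr_ae (ae_of_all _ fun ω => ?_)) (h0 r)
    simp only
    rcases le_total (D ω) 0 with h | h
    · rw [max_eq_right h, max_eq_left (by linarith)]; ring
    · rw [max_eq_left h, max_eq_right (by linarith)]; ring
  have hz : (P.withDensity fun ω => ENNReal.ofReal (D ω)) = 0 ↔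
      (P.withDensity fun ω => ENNReal.ofReal (-D ω)) = 0 := by
    have := congrFun hmgf 0
    simp only [mgf_zero'] at this
    rw [← Measure.measure_univ_eq_zero, ← Measure.measure_univ_eq_zero, ← measureReal_eq_zero_iff,
      ← measureReal_eq_zero_iff, this]
  refine Measure.ext_of_complexMGF_eq hV.aemeasurable hV.aemeasurable (funext fun z => ?_)
  refine eqOn_complexMGF_of_mgf' hmgf hz ?_
  simp [u1]

/-- The one-dimensional case applied to all linear functionals identifies the finite-dimensional
marginals of the two image measures (Cramér-Wold); the marginals determine a finite measure on the
product space, hence the integral of `D` over every event generated by `W`. -/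
theorem setIntegral_eq_zero_of_exp {J : Type*} {W : J → Ω → ℝ} (hW : ∀ i, Measurable (W i))
    {D : Ω → ℝ} (hD : Integrable D P)
    (hint : ∀ (I : Finset J) (c : I → ℝ),
      Integrable (fun ω => Real.exp (∑ i, c i * W i ω) * D ω) P)
    (h0 : ∀ (I : Finset J) (c : I → ℝ), ∫ ω, Real.exp (∑ i, c i * W i ω) * D ω ∂P = 0)
    {B : Set Ω} (hB : MeasurableSet[⨆ i, MeasurableSpace.comap (W i) inferInstance] B) :
    ∫ ω in B, D ω ∂P = 0 := by
  classical
  set Φ : Ω → J → ℝ := fun ω i => W i ω with hΦdef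
  have hΦ : Measurable Φ := measurable_pi_lambda _ hW
  have hcomap : (⨆ i, MeasurableSpace.comap (W i) inferInstance) =
      MeasurableSpace.comap Φ MeasurableSpace.pi := by
    simp only [MeasurableSpace.pi, MeasurableSpace.comap_iSup, MeasurableSpace.comap_comp]
    rfl
  rw [hcomap] at hB
  obtain ⟨S, hS, rfl⟩ := hB
  have f1 : IsFiniteMeasure (P.withDensity fun ω => ENNReal.ofReal (D ω)) :=
    isFiniteMeasure_withDensity_ofReal hD.2
  have f2 : IsFiniteMeasure (P.withDensity fun ω => ENNReal.ofReal (-D ω)) :=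
    isFiniteMeasure_withDensity_ofReal hD.neg.2
  have hmap : (P.withDensity fun ω => ENNReal.ofReal (D ω)).map Φ =
      (P.withDensity fun ω => ENNReal.ofReal (-D ω)).map Φ := by
    refine IsProjectiveLimit.unique (P := fun I : Finset J =>
      ((P.withDensity fun ω => ENNReal.ofReal (-D ω)).map Φ).map I.restrict) (fun I => ?_)
      fun I => rfl
    have hr : Measurable (I.restrict (π := fun _ : J => ℝ)) := Finset.measurable_restrict I
    refine Measure.ext_of_charFunDual (funext fun L => ?_)
    have hsum : ∀ ω, L (I.restrict (Φ ω)) = ∑ i : I, L (Pi.single i 1) * W i ω := fun ω => by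
      have hx : I.restrict (Φ ω) = ∑ i : I, W i ω • (Pi.single i (1 : ℝ) : I → ℝ) := by
        ext j
        simp [Finset.sum_apply, Pi.single_apply, hΦdef]
      rw [hx, map_sum]
      simp [mul_comm]
    beta_reduce
    rw [charFunDual_eq_charFun_map_one, charFunDual_eq_charFun_map_one,
      Measure.map_map hr hΦ, Measure.map_map hr hΦ,
      Measure.map_map L.continuous.measurable (hr.comp hΦ),
      Measure.map_map L.continuous.measurable (hr.comp hΦ),
      map_withDensity_eq_of_exp (L.continuous.measurable.comp (hr.comp hΦ)) hD]
    · intro r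
      simpa only [Function.comp_apply, hsum, Finset.mul_sum, mul_assoc] using
        hint I fun i => r * L (Pi.single i 1)
    · intro r
      simpa only [Function.comp_apply, hsum, Finset.mul_sum, mul_assoc] using
        h0 I fun i => r * L (Pi.single i 1)
  have h := congrArg (fun m => m S) hmap
  simp only [Measure.map_apply hΦ hS, withDensity_apply _ (hΦ hS)] at h
  rw [integral_eq_lintegral_pos_part_sub_lintegral_neg_part hD.integrableOn, h, sub_self]

end Totality

namespace CenteredGaussianProcess

variable {Ω : Type*} [mΩ : MeasurableSpace Ω] {P : Measure Ω} {T : ℝ}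
  (X : CenteredGaussianProcess P T)

/-! ### The Wiener integral -/

theorem wiener_coe (f : X.StepFun) :
    X.wiener (f : UniformSpace.Completion X.StepFun) = X.stepIntegral f :=
  ContinuousLinearMap.extend_eq _ UniformSpace.Completion.denseRange_coe
    (UniformSpace.Completion.isUniformInducing_coe _) f

theorem norm_wiener (h : X.Integrands) : ‖X.wiener h‖ = ‖h‖ := by
  induction h using UniformSpace.Completion.induction_on with
  | hp => exact isClosed_eq (X.wiener.continuous.norm) continuous_norm
  | ih f => rw [wiener_coe, norm_stepIntegral, UniformSpace.Completion.norm_coe]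

theorem inner_wiener (h k : X.Integrands) : inner ℝ (X.wiener h) (X.wiener k) = inner ℝ h k :=
  LinearIsometry.inner_map_map ⟨X.wiener.toLinearMap, X.norm_wiener⟩ h k

theorem wiener_indic (t : Time T) : X.wiener (X.indic t) = X.toL2 t := by
  rw [indic, wiener_coe]
  exact (Finsupp.linearCombination_single ℝ (1 : ℝ) t).trans (one_smul _ _)

theorem cameronMartin_eq_inner (h : X.Integrands) (t : Time T) :
    X.cameronMartin h t = inner ℝ (X.indic t) h := by
  rw [← inner_wiener, wiener_indic, L2.inner_def, cameronMartin]
  refine integral_congr_ae ?_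
  filter_upwards [(X.memLp t).coeFn_toLp] with ω h1
  simp only [toL2, h1]
  simp [mul_comm]

theorem measurable_toFun (t : Time T) : Measurable (X.toFun t) :=
  X.measurable.comp measurable_prodMk_left

theorem F_le (t : Time T) : X.F t ≤ mΩ :=
  iSup_le fun s => (X.measurable_toFun s.1).comap_le

theorem F_mono {s t : Time T} (h : s ≤ t) : X.F s ≤ X.F t :=
  iSup_le fun r => le_iSup (fun r : {r : Time T // r ≤ t} =>
    MeasurableSpace.comap (X.toFun r.1) inferInstance) ⟨r.1, r.2.trans h⟩

theorem F_le_finish (t : Time T) : X.F t ≤ X.F X.finish := X.F_mono t.2.2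

theorem coeFn_sum_smul_toL2 {ι : Type*} (I : Finset ι) (c : ι → ℝ) (τ : ι → Time T) :
    (∑ i ∈ I, c i • X.toL2 (τ i) : Lp ℝ 2 P) =ᵐ[P] fun ω => ∑ i ∈ I, c i * X.toFun (τ i) ω := by
  classical
  induction I using Finset.induction_on with
  | empty => simpa using! Lp.coeFn_zero ℝ 2 P
  | insert s I hs ih =>
    rw [Finset.sum_insert hs]
    filter_upwards [Lp.coeFn_add (c s • X.toL2 (τ s)) (∑ i ∈ I, c i • X.toL2 (τ i)),
      Lp.coeFn_smul (c s) (X.toL2 (τ s)), (X.memLp (τ s)).coeFn_toLp, ih] with ω h1 h2 h3 h4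
    rw [h1, Pi.add_apply, h2, h4, Finset.sum_insert hs, Pi.smul_apply, toL2, h3, smul_eq_mul]

theorem integral_wiener_sq (h : X.Integrands) : ∫ ω, (X.wiener h ω) ^ 2 ∂P = ‖h‖ ^ 2 := by
  rw [← X.norm_wiener h, ← real_inner_self_eq_norm_sq, L2.inner_def]
  refine integral_congr_ae (ae_of_all _ fun ω => ?_)
  simp [sq]

/-! ### Gaussian law of the Wiener integral -/

variable [IsProbabilityMeasure P]

theorem map_stepIntegral (f : X.StepFun) :
    P.map (X.wiener (f : UniformSpace.Completion X.StepFun)) =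
      gaussianReal 0 (‖(f : UniformSpace.Completion X.StepFun)‖₊ ^ 2) := by
  have hae : X.wiener (f : UniformSpace.Completion X.StepFun) =ᵐ[P]
      fun ω => ∑ t ∈ Finsupp.support f, (show Time T →₀ ℝ from f) t * X.toFun t ω := by
    rw [wiener_coe]
    exact X.coeFn_sum_smul_toL2 _ _ id
  have hlaw : HasGaussianLaw
      (fun ω => ∑ t ∈ Finsupp.support f, (show Time T →₀ ℝ from f) t * X.toFun t ω) P :=
    (X.gaussian.smul fun t => (show Time T →₀ ℝ from f) t).hasGaussianLaw_fun_sum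
  have hmean : ∫ ω, ∑ t ∈ Finsupp.support f,
      (show Time T →₀ ℝ from f) t * X.toFun t ω ∂P = 0 := by
    rw [integral_finsetSum _ fun t _ => ((X.memLp t).integrable one_le_two).const_mul _]
    simp [integral_const_mul, X.centered]
  have hlaw' := hlaw.congr hae.symm
  have hmean' := (integral_congr_ae hae).trans hmean
  rw [hlaw'.map_eq_gaussianReal, hmean', variance_of_integral_eq_zero hlaw'.aemeasurable hmean',
    integral_wiener_sq]
  congr 1
  ext
  simp

/-- The law is known on step functions, which are dense, and both characteristic functions depend
continuously on `h`. -/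
theorem map_wiener (h : X.Integrands) : P.map (X.wiener h) = gaussianReal 0 (‖h‖₊ ^ 2) := by
  have : IsProbabilityMeasure (P.map (X.wiener h)) :=
    Measure.isProbabilityMeasure_map (Lp.aestronglyMeasurable _).aemeasurable
  refine Measure.ext_of_charFun (funext fun r => ?_)
  have hchar : ∀ f : Lp ℝ 2 P, charFun (P.map f) r = ∫ ω, Complex.exp (r * f ω * Complex.I) ∂P :=
    fun f => by
      rw [charFun_apply_real,
        integral_map (Lp.aestronglyMeasurable f).aemeasurable (by fun_prop)]
  have hint : ∀ f : Lp ℝ 2 P, Integrable (fun ω => Complex.exp (r * f ω * Complex.I)) P := by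
    intro f
    refine Integrable.of_bound (C := 1) ?_ (ae_of_all _ fun ω => ?_)
    · have := (Lp.aestronglyMeasurable f)
      fun_prop
    · rw [← Complex.ofReal_mul, Complex.norm_exp_ofReal_mul_I]
  -- Lipschitz with constant `|r|`, from `|e^{ix} - e^{iy}| ≤ |x - y|` and the domination of the
  -- `L¹` norm by the `L²` norm.
  have hcont : Continuous fun f : Lp ℝ 2 P => ∫ ω, Complex.exp (r * f ω * Complex.I) ∂P := by
    refine LipschitzWith.continuous (K := ‖r‖₊) (LipschitzWith.of_dist_le_mul fun f g => ?_)
    rw [dist_eq_norm, dist_eq_norm, ← integral_sub (hint f) (hint g)]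
    have hfg : Integrable (f - g : Lp ℝ 2 P) P := (Lp.memLp (f - g)).integrable one_le_two
    calc ‖∫ ω, (Complex.exp (r * f ω * Complex.I) - Complex.exp (r * g ω * Complex.I)) ∂P‖
        ≤ ∫ ω, ‖r‖ * ‖(f - g : Lp ℝ 2 P) ω‖ ∂P := by
          refine norm_integral_le_of_norm_le (hfg.norm.const_mul _) ?_
          filter_upwards [Lp.coeFn_sub f g] with ω hω
          rw [hω, Pi.sub_apply, ← norm_mul, mul_sub]
          have h1 : ∀ x y : ℝ, ‖Complex.exp (x * Complex.I) - Complex.exp (y * Complex.I)‖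
              ≤ ‖x - y‖ := fun x y => by
            have : Complex.exp (x * Complex.I) - Complex.exp (y * Complex.I) =
                Complex.exp (y * Complex.I) *
                  (Complex.exp (Complex.I * ((x - y : ℝ) : ℂ)) - 1) := by
              rw [mul_sub, ← Complex.exp_add]
              push_cast
              ring_nf
            rw [this, norm_mul, Complex.norm_exp_ofReal_mul_I, one_mul]
            exact Real.norm_exp_I_mul_ofReal_sub_one_le
          simpa using h1 (r * f ω) (r * g ω)
      _ ≤ ‖r‖ * ‖f - g‖ := by
          rw [integral_const_mul]
          refine mul_le_mul_of_nonneg_left ?_ (norm_nonneg _)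
          rw [integral_norm_eq_lintegral_enorm hfg.1, Lp.norm_def,
            ← eLpNorm_one_eq_lintegral_enorm]
          exact ENNReal.toReal_mono (Lp.eLpNorm_ne_top _)
            (eLpNorm_le_eLpNorm_of_exponent_le one_le_two hfg.1)
  rw [hchar]
  clear this
  induction h using UniformSpace.Completion.induction_on with
  | hp =>
    simp only [charFun_gaussianReal]
    refine isClosed_eq (hcont.comp X.wiener.continuous) ?_
    push_cast
    fun_prop
  | ih f => rw [← hchar, map_stepIntegral]

end CenteredGaussianProcess

/-! ### Conditional expectation against measurable factors -/

section

variable {Ω : Type*} [mΩ : MeasurableSpace Ω] {P : Measure Ω} [IsFiniteMeasure P]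

theorem integral_condExp_mul {m : MeasurableSpace Ω} (hm : m ≤ mΩ) {D η : Ω → ℝ}
    (hη : AEStronglyMeasurable[m] η P) (hηD : Integrable (fun ω => D ω * η ω) P)
    (hD : Integrable D P) : ∫ ω, (P[D | m]) ω * η ω ∂P = ∫ ω, D ω * η ω ∂P := by
  have h1 := condExp_mul_of_aestronglyMeasurable_right hη hηD hD
  have h2 := integral_condExp hm (μ := P) (f := D * η)
  rw [integral_congr_ae h1] at h2
  exact h2

end

namespace CenteredGaussianProcess

variable {Ω : Type*} [mΩ : MeasurableSpace Ω] {P : Measure Ω} {T : ℝ}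
  (X : CenteredGaussianProcess P T)

/-! ### Wick exponentials and the `S`-transform -/

theorem wickExp_wiener (h : X.Integrands) :
    wickExp (X.wiener h) = fun ω => Real.exp (X.wiener h ω - ‖h‖ ^ 2 / 2) := by
  ext ω
  rw [wickExp, integral_wiener_sq]

theorem aestronglyMeasurable_wickExp (h : X.Integrands) :
    AEStronglyMeasurable (wickExp (X.wiener h)) P := by
  have := Lp.aestronglyMeasurable (X.wiener h)
  rw [wickExp_wiener]
  fun_prop

theorem wickExp_mul_wickExp (h k : X.Integrands) :
    (fun ω => wickExp (X.wiener h) ω * wickExp (X.wiener k) ω) =ᵐ[P]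
      fun ω => Real.exp (inner ℝ h k) * wickExp (X.wiener (h + k)) ω := by
  filter_upwards [Lp.coeFn_add (X.wiener h) (X.wiener k)] with ω hω
  simp only [wickExp_wiener]
  rw [map_add, hω, Pi.add_apply, ← Real.exp_add, ← Real.exp_add, norm_add_sq_real]
  congr 1
  ring

theorem S_congr {E : Type*} [NormedAddCommGroup E] [NormedSpace ℝ E] {ξ η : Ω → E}
    (h : ξ =ᵐ[P] η) (k : X.Integrands) : X.S ξ k = X.S η k := by
  refine integral_congr_ae ?_
  filter_upwards [h] with ω hω
  rw [hω]

theorem S_const_mul (r : ℝ) (ξ : Ω → ℝ) (k : X.Integrands) :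
    X.S (fun ω => r * ξ ω) k = r * X.S ξ k := by
  simp only [S, smul_eq_mul, mul_left_comm _ r]
  exact integral_const_mul _ _

theorem S_mul_const (r : ℝ) (ξ : Ω → ℝ) (k : X.Integrands) :
    X.S (fun ω => ξ ω * r) k = X.S ξ k * r := by
  simp only [mul_comm _ r, S_const_mul]

/-- Up to a deterministic factor, exponentials of linear combinations of the `X_s` are Wick
exponentials; this links `setIntegral_eq_zero_of_exp` to the `S`-transform. -/
theorem exp_sum_mul_eq_wickExp {ι : Type*} [Fintype ι] (τ : ι → Time T) (c : ι → ℝ)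
    (D : Ω → ℝ) :
    (fun ω => Real.exp (∑ i, c i * X.toFun (τ i) ω) * D ω) =ᵐ[P]
      fun ω => Real.exp (‖∑ i, c i • X.indic (τ i)‖ ^ 2 / 2) *
        (wickExp (X.wiener (∑ i, c i • X.indic (τ i))) ω * D ω) := by
  have hk1 : X.wiener (∑ i, c i • X.indic (τ i)) = ∑ i, c i • X.toL2 (τ i) := by
    rw [map_sum]
    exact Finset.sum_congr rfl fun i _ => by rw [map_smul, wiener_indic]
  have hk2 := X.coeFn_sum_smul_toL2 Finset.univ c τ
  rw [← hk1] at hk2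
  filter_upwards [hk2] with ω hω
  rw [wickExp_wiener, ← hω, ← mul_assoc, ← Real.exp_add]
  congr 2
  ring

section

variable [IsProbabilityMeasure P]

theorem integrable_exp_wiener (h : X.Integrands) :
    Integrable (fun ω => Real.exp (X.wiener h ω)) P := by
  have h1 := integrable_exp_mul_gaussianReal (μ := 0) (v := ‖h‖₊ ^ 2) 1
  rw [← X.map_wiener h, integrable_map_measure (by fun_prop)
    (Lp.aestronglyMeasurable _).aemeasurable] at h1
  simpa [Function.comp_def] using h1

theorem integrable_wickExp (h : X.Integrands) : Integrable (wickExp (X.wiener h)) P := by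
  rw [wickExp_wiener]
  simp only [Real.exp_sub]
  exact (X.integrable_exp_wiener h).div_const _

theorem integral_wickExp (h : X.Integrands) : ∫ ω, wickExp (X.wiener h) ω ∂P = 1 := by
  have h1 := mgf_gaussianReal (X.map_wiener h) 1
  simp only [mgf, one_mul] at h1
  rw [wickExp_wiener]
  simp only [Real.exp_sub]
  rw [integral_div, h1, ← Real.exp_sub]
  simp

theorem integral_wickExp_mul_wickExp (h k : X.Integrands) :
    ∫ ω, wickExp (X.wiener h) ω * wickExp (X.wiener k) ω ∂P = Real.exp (inner ℝ h k) := by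
  rw [integral_congr_ae (X.wickExp_mul_wickExp h k), integral_const_mul, integral_wickExp, mul_one]

theorem memLp_wickExp (h : X.Integrands) : MemLp (wickExp (X.wiener h)) 2 P := by
  rw [memLp_two_iff_integrable_sq (X.aestronglyMeasurable_wickExp h)]
  simp only [sq]
  exact ((X.integrable_wickExp (h + h)).const_mul _).congr (X.wickExp_mul_wickExp h h).symm

/-- The Wick exponential of the Wiener integral of `h` as an element of `L²(P)`. -/
def wickL2 (h : X.Integrands) : Lp ℝ 2 P := (X.memLp_wickExp h).toLp _

theorem inner_wickL2 (h k : X.Integrands) :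
    inner ℝ (X.wickL2 h) (X.wickL2 k) = Real.exp (inner ℝ h k) := by
  rw [← integral_wickExp_mul_wickExp, L2.inner_def]
  refine integral_congr_ae ?_
  filter_upwards [(X.memLp_wickExp h).coeFn_toLp, (X.memLp_wickExp k).coeFn_toLp] with ω h1 h2
  simp only [wickL2, h1, h2]
  simp [mul_comm]

/-- Inner products of Wick exponentials are `exp ⟪h, k⟫`, so the distance between two of them is an
explicit continuous function. -/
theorem continuous_wickL2 : Continuous X.wickL2 := by
  rw [continuous_iff_continuousAt]
  intro h
  rw [ContinuousAt, tendsto_iff_norm_sub_tendsto_zero]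
  have h1 : ∀ k, ‖X.wickL2 k - X.wickL2 h‖ =
      √(Real.exp (inner ℝ k k) - 2 * Real.exp (inner ℝ k h) + Real.exp (inner ℝ h h)) := by
    intro k
    rw [norm_eq_sqrt_real_inner, inner_sub_left, inner_sub_right, inner_sub_right]
    simp only [inner_wickL2, real_inner_comm k h]
    congr 1
    ring
  simp only [h1]
  have h2 : Continuous fun k : X.Integrands =>
      √(Real.exp (inner ℝ k k) - 2 * Real.exp (inner ℝ k h) + Real.exp (inner ℝ h h)) := by
    fun_prop
  have := h2.tendsto h
  convert this using 2
  rw [eq_comm, Real.sqrt_eq_zero']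
  linarith

theorem integrable_wickExp_smul {E : Type*} [NormedAddCommGroup E] [NormedSpace ℝ E]
    {ξ : Ω → E} (hξ : MemLp ξ 2 P) (h : X.Integrands) :
    Integrable (fun ω => wickExp (X.wiener h) ω • ξ ω) P :=
  memLp_one_iff_integrable.1 (hξ.smul (X.memLp_wickExp h))

theorem integrable_wickExp_mul {ξ : Ω → ℝ} (hξ : MemLp ξ 2 P) (h : X.Integrands) :
    Integrable (fun ω => wickExp (X.wiener h) ω * ξ ω) P :=
  X.integrable_wickExp_smul hξ h

theorem S_eq_inner {ξ : Ω → ℝ} (hξ : MemLp ξ 2 P) (h : X.Integrands) :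
    X.S ξ h = inner ℝ (X.wickL2 h) (hξ.toLp ξ) := by
  rw [L2.inner_def, S]
  refine integral_congr_ae ?_
  filter_upwards [(X.memLp_wickExp h).coeFn_toLp, hξ.coeFn_toLp] with ω h1 h2
  simp only [wickL2, h1, h2]
  simp [mul_comm]

theorem continuous_S {ξ : Ω → ℝ} (hξ : MemLp ξ 2 P) : Continuous (X.S ξ) := by
  simp only [funext (X.S_eq_inner hξ)]
  exact X.continuous_wickL2.inner continuous_const

theorem S_sub {ξ η : Ω → ℝ} (hξ : MemLp ξ 2 P) (hη : MemLp η 2 P) (k : X.Integrands) :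
    X.S (fun ω => ξ ω - η ω) k = X.S ξ k - X.S η k := by
  simp only [S, smul_sub]
  exact integral_sub (X.integrable_wickExp_smul hξ k) (X.integrable_wickExp_smul hη k)

theorem S_clm_comp {E E' : Type*} [NormedAddCommGroup E] [NormedSpace ℝ E] [CompleteSpace E]
    [NormedAddCommGroup E'] [NormedSpace ℝ E'] [CompleteSpace E'] (L : E →L[ℝ] E') {Z : Ω → E}
    (hZ : MemLp Z 2 P) (k : X.Integrands) : X.S (fun ω => L (Z ω)) k = L (X.S Z k) := by
  simp only [S]
  rw [← L.integral_comp_comm (X.integrable_wickExp_smul hZ k)]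
  simp

/-! ### Totality of the Wick exponentials -/

/-- The condition on `k` says that `⟪k, ·⟫` sees only Cameron-Martin functions on `[0, u]`. It holds
for combinations of `1_{(0,s]}` with `s ≤ u`, whose Wick exponentials suffice to test events of
`F_u`. -/
theorem condExp_eq_zero_of_wickExp (u : Time T) {D : Ω → ℝ} (hD : MemLp D 2 P)
    (h0 : ∀ k : X.Integrands, (∀ h h' : X.Integrands,
      (∀ s ≤ u, inner ℝ (X.indic s) h = inner ℝ (X.indic s) h') → inner ℝ k h = inner ℝ k h') →
      ∫ ω, wickExp (X.wiener k) ω * D ω ∂P = 0) : P[D | X.F u] =ᵐ[P] 0 := by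
  have hDi : Integrable D P := hD.integrable one_le_two
  have key : ∀ s, MeasurableSet[X.F u] s → ∫ ω in s, D ω ∂P = 0 := by
    intro s hs
    refine setIntegral_eq_zero_of_exp (J := {s : Time T // s ≤ u}) (W := fun i => X.toFun i.1)
      (fun i => X.measurable_toFun i.1) hDi (fun I c => ?_) (fun I c => ?_) hs
    · exact ((X.integrable_wickExp_mul hD _).const_mul _).congr
        (X.exp_sum_mul_eq_wickExp (fun i : I => i.1.1) c D).symm
    · refine (integral_congr_ae (X.exp_sum_mul_eq_wickExp (fun i : I => i.1.1) c D)).trans ?_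
      rw [integral_const_mul, h0, mul_zero]
      intro h h' hh
      simp only [sum_inner, real_inner_smul_left]
      exact Finset.sum_congr rfl fun i _ => by rw [hh _ i.1.2]
  refine (ae_eq_condExp_of_forall_setIntegral_eq (X.F_le u) hDi
    (fun s _ _ => integrableOn_zero) (fun s hs _ => ?_) aestronglyMeasurable_zero).symm
  rw [key s hs]
  simp

/-- The `S`-transform of an `F_u`-measurable random variable at `h` depends only on the restriction
to `[0, u]` of the Cameron-Martin function that corresponds to `h`. -/
theorem S_eq_of_adapted {u : Time T} {η : Ω → ℝ} (hη : MemLp η 2 P)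
    (hηu : AEStronglyMeasurable[X.F u] η P) {h k : X.Integrands}
    (hhk : ∀ s ≤ u, inner ℝ (X.indic s) h = inner ℝ (X.indic s) k) : X.S η h = X.S η k := by
  have hD := (X.memLp_wickExp h).sub (X.memLp_wickExp k)
  have e : ∀ ξ : Ω → ℝ, ∀ ω, (wickExp (X.wiener h) - wickExp (X.wiener k)) ω * ξ ω =
      wickExp (X.wiener h) ω * ξ ω - wickExp (X.wiener k) ω * ξ ω := fun ξ ω => by
    rw [Pi.sub_apply, sub_mul]
  -- The difference of the two Wick exponentials tests to `exp ⟪h, l⟫ - exp ⟪k, l⟫ = 0`, so its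
  -- conditional expectation given `F_u` vanishes and it is orthogonal to `η`.
  have key := X.condExp_eq_zero_of_wickExp u hD fun l hl => by
    simp only [mul_comm (wickExp (X.wiener l) _), e]
    rw [integral_sub (X.integrable_wickExp_mul (X.memLp_wickExp l) h)
      (X.integrable_wickExp_mul (X.memLp_wickExp l) k), integral_wickExp_mul_wickExp,
      integral_wickExp_mul_wickExp, real_inner_comm, hl h k hhk, real_inner_comm, sub_self]
  have hi1 := X.integrable_wickExp_mul hη h
  have hi2 := X.integrable_wickExp_mul hη k
  have h3 := integral_condExp_mul (X.F_le u) hηu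
    ((hi1.sub hi2).congr (ae_of_all _ fun ω => (e η ω).symm)) (hD.integrable one_le_two)
  rw [integral_eq_zero_of_ae (by filter_upwards [key] with ω hω; simp [hω])] at h3
  simp only [e] at h3
  rw [integral_sub hi1 hi2, eq_comm, sub_eq_zero] at h3
  simpa only [S, smul_eq_mul] using h3

/-- The case `u = T`, where `ξ` is its own conditional expectation. -/
theorem eq_zero_of_S_eq_zero {ξ : Ω → ℝ} (hξ : X.MemL2 ξ) (h0 : ∀ h, X.S ξ h = 0) :
    ξ =ᵐ[P] 0 :=
  (condExp_of_aestronglyMeasurable' (X.F_le _) hξ.1 (hξ.2.integrable one_le_two)).symm.trans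
    (X.condExp_eq_zero_of_wickExp _ hξ.2 fun k _ => h0 k)

theorem eq_of_S_eq {ξ η : Ω → ℝ} (hξ : X.MemL2 ξ) (hη : X.MemL2 η)
    (h : ∀ h, X.S ξ h = X.S η h) : ξ =ᵐ[P] η := by
  have := X.eq_zero_of_S_eq_zero (ξ := fun ω => ξ ω - η ω) ⟨hξ.1.sub hη.1, hξ.2.sub hη.2⟩
    fun k => by rw [X.S_sub hξ.2 hη.2, h, sub_self]
  filter_upwards [this] with ω hω
  exact sub_eq_zero.1 hω

end

/-! ### Truncation in the Cameron-Martin space -/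

theorem trunc_ind {H : Type*} [NormedAddCommGroup H] [InnerProductSpace ℝ H] {ind : Time T → H}
    (hH : HasTruncation ind) (r t : Time T) : trunc ind r (ind t) = ind (min t r) := by
  rw [trunc, dif_pos (hH r)]
  exact (hH r).choose_spec t

/-- Passing to the adjoint turns truncation of integrands into stopping of Cameron-Martin functions
at `r`. -/
theorem inner_indic_dualTrunc (hX : X.HasIndefiniteWienerIntegral) (r t : Time T)
    (h : X.Integrands) :
    inner ℝ (X.indic t) (X.dualTrunc r h) = inner ℝ (X.indic (min t r)) h := by
  rw [dualTrunc, ContinuousLinearMap.adjoint_inner_right, trunc_ind hX]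

end CenteredGaussianProcess

/-! ### Pathwise integrals of square integrable fields -/

section Fubini

variable {α Ω : Type*} [MeasurableSpace α] {m : MeasurableSpace Ω} [mΩ : MeasurableSpace Ω] {μ : Measure α}
  {P : Measure Ω} {f : α → Ω → ℝ}

/-- A jointly measurable field with `E[(∫ |f_s| dμ(s))²] < ∞`. -/
structure IsSquareIntegrableField (μ : Measure α) (P : Measure Ω) (f : α → Ω → ℝ) : Prop where
  measurable : Measurable (Function.uncurry f)
  lintegral_lt_top : ∫⁻ ω, (∫⁻ s, ‖f s ω‖ₑ ∂μ) ^ 2 ∂P < ∞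

theorem memLp_two_iff_lintegral_sq {g : Ω → ℝ} :
    MemLp g 2 P ↔ AEStronglyMeasurable g P ∧ ∫⁻ ω, ‖g ω‖ₑ ^ 2 ∂P < ∞ := by
  rw [MemLp, eLpNorm_lt_top_iff_lintegral_rpow_enorm_lt_top two_ne_zero ENNReal.ofNat_ne_top]
  simp

namespace IsSquareIntegrableField

theorem of_enorm_le {f' : α → Ω → ℝ} (hf : IsSquareIntegrableField μ P f)
    (hm : Measurable (Function.uncurry f')) {C : ℝ≥0∞} (hC : C ≠ ∞)
    (hle : ∀ s ω, ‖f' s ω‖ₑ ≤ C * ‖f s ω‖ₑ) : IsSquareIntegrableField μ P f' := by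
  refine ⟨hm, ?_⟩
  calc ∫⁻ ω, (∫⁻ s, ‖f' s ω‖ₑ ∂μ) ^ 2 ∂P
      ≤ ∫⁻ ω, C ^ 2 * (∫⁻ s, ‖f s ω‖ₑ ∂μ) ^ 2 ∂P := by
        refine lintegral_mono fun ω => ?_
        rw [← mul_pow, ← lintegral_const_mul' _ _ hC]
        gcongr
        exact hle _ _
    _ = C ^ 2 * ∫⁻ ω, (∫⁻ s, ‖f s ω‖ₑ ∂μ) ^ 2 ∂P :=
        lintegral_const_mul' _ _ (ENNReal.pow_ne_top hC)
    _ < ∞ := ENNReal.mul_lt_top (ENNReal.pow_lt_top hC.lt_top) hf.lintegral_lt_top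

theorem restrict (hf : IsSquareIntegrableField μ P f) (E : Set α) :
    IsSquareIntegrableField (μ.restrict E) P f := by
  refine ⟨hf.measurable, lt_of_le_of_lt (lintegral_mono fun ω => ?_) hf.lintegral_lt_top⟩
  beta_reduce
  gcongr
  exact Measure.restrict_le_self

variable [IsFiniteMeasure μ] [IsFiniteMeasure P]

theorem integrable_mul (hf : IsSquareIntegrableField μ P f) {D : Ω → ℝ} (hD : MemLp D 2 P) :
    Integrable (fun p : α × Ω => D p.2 * f p.1 p.2) (μ.prod P) := by
  have hm : AEStronglyMeasurable (fun p : α × Ω => D p.2 * f p.1 p.2) (μ.prod P) :=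
    hD.1.comp_snd.mul hf.measurable.aestronglyMeasurable
  refine ⟨hm, ?_⟩
  rw [HasFiniteIntegral, lintegral_prod_symm _ hm.enorm]
  calc ∫⁻ ω, ∫⁻ s, ‖D ω * f s ω‖ₑ ∂μ ∂P
      ≤ ∫⁻ ω, (‖D ω‖ₑ ^ 2 + (∫⁻ s, ‖f s ω‖ₑ ∂μ) ^ 2) ∂P := by
        refine lintegral_mono fun ω => ?_
        simp only [enorm_mul]
        rw [lintegral_const_mul' _ _ enorm_ne_top, sq, sq]
        -- A product is at most the square of its larger factor, hence at most the sum of both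
        -- squares.
        rcases le_total ‖D ω‖ₑ (∫⁻ s, ‖f s ω‖ₑ ∂μ) with h | h
        · exact (mul_le_mul_left h _).trans le_add_self
        · exact (mul_le_mul_right h _).trans le_self_add
    _ = ∫⁻ ω, ‖D ω‖ₑ ^ 2 ∂P + ∫⁻ ω, (∫⁻ s, ‖f s ω‖ₑ ∂μ) ^ 2 ∂P :=
        lintegral_add_left' (hD.1.enorm.pow_const 2) _
    _ < ∞ := ENNReal.add_lt_top.2 ⟨(memLp_two_iff_lintegral_sq.1 hD).2, hf.lintegral_lt_top⟩

theorem integrable (hf : IsSquareIntegrableField μ P f) :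
    Integrable (fun p : α × Ω => f p.1 p.2) (μ.prod P) := by
  simpa using hf.integrable_mul (memLp_const (1 : ℝ))

theorem ae_integrable (hf : IsSquareIntegrableField μ P f) :
    ∀ᵐ ω ∂P, Integrable (fun s => f s ω) μ :=
  hf.integrable.prod_left_ae

theorem memLp_integral (hf : IsSquareIntegrableField μ P f) :
    MemLp (fun ω => ∫ s, f s ω ∂μ) 2 P := by
  rw [memLp_two_iff_lintegral_sq]
  refine ⟨hf.integrable.swap.1.integral_prod_right',
    lt_of_le_of_lt (lintegral_mono fun ω => ?_) hf.lintegral_lt_top⟩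
  beta_reduce
  gcongr
  exact enorm_integral_le_lintegral_enorm _

theorem integral_mul_integral (hf : IsSquareIntegrableField μ P f) {D : Ω → ℝ}
    (hD : MemLp D 2 P) :
    ∫ ω, D ω * ∫ s, f s ω ∂μ ∂P = ∫ s, ∫ ω, D ω * f s ω ∂P ∂μ := by
  rw [integral_integral_swap (f := fun s ω => D ω * f s ω) (hf.integrable_mul hD)]
  simp only [integral_const_mul]

theorem integrable_integral_mul (hf : IsSquareIntegrableField μ P f) {D : Ω → ℝ}
    (hD : MemLp D 2 P) : Integrable (fun s => ∫ ω, D ω * f s ω ∂P) μ :=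
  (hf.integrable_mul hD).integral_prod_left

/-- The integral of an adapted field is adapted, although the field need not be progressively
measurable. -/
theorem aestronglyMeasurable_integral (hm : m ≤ mΩ)
    (hf : IsSquareIntegrableField μ P f) (hfm : ∀ᵐ s ∂μ, AEStronglyMeasurable[m] (f s) P) :
    AEStronglyMeasurable[m] (fun ω => ∫ s, f s ω ∂μ) P := by
  set W : Ω → ℝ := fun ω => ∫ s, f s ω ∂μ with hW
  have hW2 : MemLp W 2 P := hf.memLp_integral
  have hWi := hW2.integrable one_le_two
  have hmul : ∀ {g h : Ω → ℝ}, MemLp g 2 P → MemLp h 2 P → Integrable (fun ω => g ω * h ω) P :=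
    fun hg hh => hg.integrable_mul hh
  suffices h : W =ᵐ[P] P[W | m] from
    stronglyMeasurable_condExp.aestronglyMeasurable.congr h.symm
  refine Integrable.ae_eq_of_forall_setIntegral_eq _ _ hWi integrable_condExp fun B hB _ => ?_
  set D : Ω → ℝ := B.indicator fun _ => 1 with hDdef
  have hD2 : MemLp D 2 P := (memLp_const 1).indicator hB
  have hDi := hD2.integrable one_le_two
  have hE2 : MemLp (P[D | m]) 2 P := hD2.condExp one_le_two
  have hset : ∀ g : Ω → ℝ, ∫ ω in B, g ω ∂P = ∫ ω, D ω * g ω ∂P := fun g => by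
    rw [← integral_indicator hB]
    congr with ω
    by_cases hω : ω ∈ B <;> simp [hDdef, hω]
  rw [hset, hset]
  -- Fubini reduces to each `f s`, against which `D` may be replaced by `P[D | m]`; after returning
  -- to `W`, self-adjointness moves the conditional expectation from `D` to `W`.
  calc ∫ ω, D ω * W ω ∂P = ∫ s, ∫ ω, D ω * f s ω ∂P ∂μ := hf.integral_mul_integral hD2
    _ = ∫ s, ∫ ω, (P[D | m]) ω * f s ω ∂P ∂μ := by
        refine integral_congr_ae ?_
        filter_upwards [hfm, (hf.integrable_mul hD2).prod_right_ae] with s h1 h2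
        exact (integral_condExp_mul hm h1 h2 hDi).symm
    _ = ∫ ω, (P[D | m]) ω * W ω ∂P := (hf.integral_mul_integral hE2).symm
    _ = ∫ ω, W ω * (P[D | m]) ω ∂P := by simp only [mul_comm]
    _ = ∫ ω, (P[W | m]) ω * (P[D | m]) ω ∂P :=
        (integral_condExp_mul hm stronglyMeasurable_condExp.aestronglyMeasurable
          (hmul hW2 hE2) hWi).symm
    _ = ∫ ω, (P[D | m]) ω * (P[W | m]) ω ∂P := by simp only [mul_comm]
    _ = ∫ ω, D ω * (P[W | m]) ω ∂P :=
        integral_condExp_mul hm stronglyMeasurable_condExp.aestronglyMeasurable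
          (hmul hD2 (hW2.condExp one_le_two)) hDi

end IsSquareIntegrableField

end Fubini

/-! ### Calculus in a space of integrands -/

section Hilbert

variable {T : ℝ} {H : Type*} [NormedAddCommGroup H] [InnerProductSpace ℝ H] {ind : Time T → H}

theorem detIntegral_ind {g : Time T → ℝ} (hg : IsSpaceOfIntegrands ind g) (t : Time T) :
    detIntegral ind g (ind t) = g t := by
  rw [detIntegral, dif_pos hg.2]
  exact hg.2.choose_spec t

theorem IsIndicatorSystem.clm_ext (hind : IsIndicatorSystem ind) {L L' : H →L[ℝ] ℝ}
    (h : ∀ t, L (ind t) = L' (ind t)) : L = L' := by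
  refine ContinuousLinearMap.ext_on (s := Set.range ind) ?_ ?_
  · rw [Submodule.dense_iff_topologicalClosure_eq_top]
    exact hind.total
  · rintro _ ⟨t, rfl⟩
    exact h t

end Hilbert

namespace CenteredGaussianProcess

variable {Ω : Type*} [mΩ : MeasurableSpace Ω] {P : Measure Ω} {T : ℝ}
  (X : CenteredGaussianProcess P T)

theorem Ioc_finish (t : Time T) : Set.Ioc t X.finish = Set.Ioi t := by
  ext s
  simp only [Set.mem_Ioc, Set.mem_Ioi, and_iff_left_iff_imp]
  exact fun _ => s.2.2

section Skorokhod

variable {H : Type*} [NormedAddCommGroup H] [InnerProductSpace ℝ H] {ind : Time T → H}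

theorem cameronMartin_shift (hX : X.HasIndefiniteWienerIntegral) (u : Time T)
    (h c : X.Integrands) (t : Time T) :
    X.cameronMartin (X.dualTrunc u (h + c) - c) t =
      X.cameronMartin h (min t u) + X.cameronMartin c (min t u) - X.cameronMartin c t := by
  simp only [cameronMartin_eq_inner, inner_sub_right, X.inner_indic_dualTrunc hX, inner_add_right]

/-- Integration against a stopped function is integration of the truncated integrand. Membership is
what allows the Skorokhod identity to be tested at the shifted point. -/
theorem shift_mem_goodIntegrators (hX : X.HasIndefiniteWienerIntegral) (hH : HasTruncation ind)
    {c h : X.Integrands} (hc : IsSpaceOfIntegrands ind (X.cameronMartin c))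
    (hh : h ∈ X.goodIntegrators ind) (u : Time T) :
    X.dualTrunc u (h + c) - c ∈ X.goodIntegrators ind := by
  refine ⟨hc.1, (detIntegral ind (X.cameronMartin h) + detIntegral ind (X.cameronMartin c)).comp
    (trunc ind u) - detIntegral ind (X.cameronMartin c), fun t => ?_⟩
  simp only [sub_apply, ContinuousLinearMap.comp_apply,
    add_apply, trunc_ind hH]
  rw [detIntegral_ind hh, detIntegral_ind hc, detIntegral_ind hc, X.cameronMartin_shift hX]

/-- The sum of the two integrators `c` and `(h + c)^u - c` is constant after `u`. -/
theorem detIntegral_truncIoc_add_shift (hX : X.HasIndefiniteWienerIntegral)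
    (hH : HasTruncation ind) {c h : X.Integrands}
    (hc : IsSpaceOfIntegrands ind (X.cameronMartin c)) (hh : h ∈ X.goodIntegrators ind)
    {u t : Time T} (hut : u ≤ t) (z : H) :
    detIntegral ind (X.cameronMartin c) (truncIoc ind t X.finish z) +
      detIntegral ind (X.cameronMartin (X.dualTrunc u (h + c) - c))
        (truncIoc ind t X.finish z) = 0 := by
  have hg := X.shift_mem_goodIntegrators hX hH hc hh u
  have key : (detIntegral ind (X.cameronMartin c) +
      detIntegral ind (X.cameronMartin (X.dualTrunc u (h + c) - c))).comp
        (truncIoc ind t X.finish) = 0 := by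
    refine hc.1.clm_ext fun r => ?_
    have hr : min r X.finish = r := min_eq_left r.2.2
    have hr' : min (min r t) u = min r u := by rw [min_assoc, min_eq_right hut]
    simp only [ContinuousLinearMap.comp_apply, add_apply, truncIoc,
      sub_apply, trunc_ind hH, map_sub, zero_apply]
    rw [detIntegral_ind hc, detIntegral_ind hc, detIntegral_ind hg, detIntegral_ind hg,
      X.cameronMartin_shift hX, X.cameronMartin_shift hX, hr, hr']
    ring
  exact congrArg (fun L => L z) key

end Skorokhod

/-! ### The linear BSDE under the `S`-transform -/

section BSDE

set_option linter.unusedSectionVars false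

variable [IsProbabilityMeasure P] {γ : Time T → ℝ} {hγ : BoundedVariationOn γ Set.univ}
  {a : Time T → ℝ} {G : Time T → Ω → ℝ} {c : X.Integrands} {ξ : Ω → ℝ} {σ : Time T → ℝ}

theorem MemL2.sub {X : CenteredGaussianProcess P T} {ξ η : Ω → ℝ} (hξ : X.MemL2 ξ)
    (hη : X.MemL2 η) : X.MemL2 fun ω => ξ ω - η ω :=
  ⟨hξ.1.sub hη.1, hξ.2.sub hη.2⟩

theorem MemL2.const_mul {X : CenteredGaussianProcess P T} {ξ : Ω → ℝ} (hξ : X.MemL2 ξ) (r : ℝ) :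
    X.MemL2 fun ω => r * ξ ω :=
  ⟨hξ.1.const_mul r, hξ.2.const_mul r⟩

theorem S_integral {μ : Measure (Time T)} [IsFiniteMeasure μ] {f : Time T → Ω → ℝ}
    (hf : IsSquareIntegrableField μ P f) (h : X.Integrands) :
    X.S (fun ω => ∫ s, f s ω ∂μ) h = ∫ s, X.S (f s) h ∂μ := by
  simpa only [S, smul_eq_mul] using hf.integral_mul_integral (X.memLp_wickExp h)

theorem integrable_S {μ : Measure (Time T)} [IsFiniteMeasure μ] {f : Time T → Ω → ℝ}
    (hf : IsSquareIntegrableField μ P f) (h : X.Integrands) :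
    Integrable (fun s => X.S (f s) h) μ := by
  simpa only [S, smul_eq_mul] using hf.integrable_integral_mul (X.memLp_wickExp h)

/-- `σ` is a density of the signed measure `dγ` with respect to its total variation. -/
structure IsSignDensity (hγ : BoundedVariationOn γ Set.univ) (σ : Time T → ℝ) : Prop where
  measurable : Measurable σ
  abs_eq : ∀ x, |σ x| = 1
  apply_eq : ∀ s, MeasurableSet s → hγ.vectorMeasure s = ∫ x in s, σ x ∂hγ.vectorMeasure.variation

namespace IsSignDensity

theorem setIntegral_eq (hσ : IsSignDensity hγ σ) {f : Time T → ℝ}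
    (hf : Integrable f hγ.vectorMeasure.variation) {s : Set (Time T)} (hs : MeasurableSet s) :
    ∫ᵛ x in s, f x ∂•hγ.vectorMeasure = ∫ x in s, f x * σ x ∂hγ.vectorMeasure.variation :=
  setIntegral_eq_setIntegral_density hσ.measurable hσ.abs_eq hσ.apply_eq hf hs

theorem integrable_mul (hσ : IsSignDensity hγ σ) {f : Time T → ℝ}
    (hf : Integrable f hγ.vectorMeasure.variation) :
    Integrable (fun s => f s * σ s) hγ.vectorMeasure.variation :=
  hf.mul_bdd (c := 1) hσ.measurable.aestronglyMeasurable
    (ae_of_all _ fun x => by simp [hσ.abs_eq])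

theorem field_mul (hσ : IsSignDensity hγ σ) {f : Time T → Ω → ℝ}
    (hf : IsSquareIntegrableField hγ.vectorMeasure.variation P f) :
    IsSquareIntegrableField hγ.vectorMeasure.variation P fun s ω => f s ω * σ s := by
  refine hf.of_enorm_le (hf.measurable.mul (hσ.measurable.comp measurable_fst)) ENNReal.one_ne_top
    fun s ω => ?_
  rw [enorm_mul, Real.enorm_eq_ofReal_abs (σ s), hσ.abs_eq]
  simp

theorem setIntegral_field_ae (hσ : IsSignDensity hγ σ) {f : Time T → Ω → ℝ}
    (hf : IsSquareIntegrableField hγ.vectorMeasure.variation P f) {E : Set (Time T)}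
    (hE : MeasurableSet E) :
    (fun ω => ∫ᵛ s in E, f s ω ∂•hγ.vectorMeasure) =ᵐ[P]
      fun ω => ∫ s in E, f s ω * σ s ∂hγ.vectorMeasure.variation := by
  filter_upwards [hf.ae_integrable] with ω hω
  exact hσ.setIntegral_eq hω hE

variable (hσ : IsSignDensity hγ σ) (hint : Integrable a hγ.vectorMeasure.variation)
include hσ hint

theorem expFactor_eq (t : Time T) : X.expFactor hγ a t =
    Real.exp (∫ s in Set.Ioi t, a s * σ s ∂hγ.vectorMeasure.variation) := by
  rw [expFactor, Ioc_finish, hσ.setIntegral_eq hint measurableSet_Ioi]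

theorem field_expFactor_mul (ha : Measurable a) {G : Time T → Ω → ℝ}
    (hG : IsSquareIntegrableField hγ.vectorMeasure.variation P G) :
    IsSquareIntegrableField hγ.vectorMeasure.variation P
      fun s ω => X.expFactor hγ a s * G s ω := by
  have hA : Measurable (X.expFactor hγ a) := by
    rw [funext (hσ.expFactor_eq X hint)]
    exact (measurable_integral_Ioi (ha.mul hσ.measurable)).exp
  refine hG.of_enorm_le ((hA.comp measurable_fst).mul hG.measurable)
    -- This constant bounds `A` uniformly, since `|σ| = 1` and `a` is integrable.
    (C := ENNReal.ofReal (Real.exp (∫ s, |a s * σ s| ∂hγ.vectorMeasure.variation)))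
    ENNReal.ofReal_ne_top fun s ω => ?_
  rw [enorm_mul]
  gcongr
  rw [hσ.expFactor_eq X hint, Real.enorm_eq_ofReal (Real.exp_pos _).le]
  exact ENNReal.ofReal_le_ofReal (Real.exp_le_exp.2
    ((le_abs_self _).trans (abs_integral_Ioi_le (hσ.integrable_mul hint) s)))

theorem aestronglyMeasurable_weightedIntegral (ha : Measurable a) (hG : X.IsAdaptedMeasurable G)
    (hG2 : IsSquareIntegrableField hγ.vectorMeasure.variation P G) (t : Time T) :
    AEStronglyMeasurable[X.F t] (X.weightedIntegral hγ a G t) P ∧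
      MemLp (X.weightedIntegral hγ a G t) 2 P := by
  have hf := hσ.field_expFactor_mul X hint ha hG2
  have hae := hσ.setIntegral_field_ae hf (measurableSet_Ioc (a := X.start) (b := t))
  have hf' := (hσ.field_mul hf).restrict (Set.Ioc X.start t)
  refine ⟨(hf'.aestronglyMeasurable_integral (X.F_le t) ?_).congr hae.symm,
    (memLp_congr_ae hae).2 hf'.memLp_integral⟩
  filter_upwards [ae_restrict_mem measurableSet_Ioc] with s hs
  exact (((hG.adapted s).mono (X.F_mono hs.2)).const_mul _).mul_const _

theorem weightedIntegral_finish (ha : Measurable a)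
    (hG2 : IsSquareIntegrableField hγ.vectorMeasure.variation P G) (u : Time T) :
    (fun ω => X.weightedIntegral hγ a G X.finish ω - X.weightedIntegral hγ a G u ω) =ᵐ[P]
      fun ω => ∫ s in Set.Ioi u, X.expFactor hγ a s * G s ω * σ s
        ∂hγ.vectorMeasure.variation := by
  have hf := hσ.field_expFactor_mul X hint ha hG2
  have hae := fun t => hσ.setIntegral_field_ae hf (measurableSet_Ioc (a := X.start) (b := t))
  filter_upwards [hae X.finish, hae u, (hσ.field_mul hf).ae_integrable] with ω h1 h2 h3
  simp only [weightedIntegral]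
  rw [h1, h2, ← X.Ioc_finish u, ← Set.Ioc_union_Ioc_eq_Ioc (b := u) u.2.1 u.2.2,
    setIntegral_union (Set.Ioc_disjoint_Ioc_of_le le_rfl) measurableSet_Ioc h3.integrableOn
      h3.integrableOn, add_sub_cancel_left]

end IsSignDensity

section Solution

variable {H : Type*} [NormedAddCommGroup H] [InnerProductSpace ℝ H] [CompleteSpace H]
  {ind : Time T → H} {Y : Time T → Ω → ℝ} {Z : Ω → H}

/-- The `S`-transform of a mild solution at `(h + c)^u - c` solves a linear integral equation on
`[u, T]` in which the terms with `Z` cancel. -/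
theorem IsMildSolution.S_equation {X : CenteredGaussianProcess P T} {c : X.Integrands}
    (hsol : X.IsMildSolution hγ a G c ξ ind Y Z)
    (hX : X.HasIndefiniteWienerIntegral) (hσ : IsSignDensity hγ σ) (hξ : X.MemL2 ξ)
    (hY2 : IsSquareIntegrableField hγ.vectorMeasure.variation P fun s ω => a s * Y s ω)
    (hG2 : IsSquareIntegrableField hγ.vectorMeasure.variation P G)
    {h : X.Integrands} (hh : h ∈ X.goodIntegrators ind) {u t : Time T} (hut : u ≤ t) :
    X.S (Y t) (X.dualTrunc u (h + c) - c) = X.S ξ (X.dualTrunc u (h + c) - c) -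
      ∫ s in Set.Ioi t, (a s * σ s * X.S (Y s) (X.dualTrunc u (h + c) - c) +
        X.S (G s) (X.dualTrunc u (h + c) - c) * σ s) ∂hγ.vectorMeasure.variation := by
  have hg := X.shift_mem_goodIntegrators hX hsol.hasTruncation hsol.spaceOfIntegrands hh u
  have hcancel := X.detIntegral_truncIoc_add_shift hX hsol.hasTruncation hsol.spaceOfIntegrands
    hh hut
  set g := X.dualTrunc u (h + c) - c with hgdef
  obtain ⟨ζ, hζ⟩ := hsol.exists_integral t
  have fY := (hσ.field_mul hY2).restrict (Set.Ioi t)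
  have fG := (hσ.field_mul hG2).restrict (Set.Ioi t)
  set L : H →L[ℝ] ℝ := (detIntegral ind (X.cameronMartin c)).comp (truncIoc ind t X.finish) with hL
  have hLZ : MemLp (fun ω => L (Z ω)) 2 P := L.comp_memLp' hsol.memL2_Z.2
  have hae : Y t =ᵐ[P] fun ω => ξ ω
      - (∫ s in Set.Ioi t, a s * Y s ω * σ s ∂hγ.vectorMeasure.variation)
      - (∫ s in Set.Ioi t, G s ω * σ s ∂hγ.vectorMeasure.variation) - L (Z ω) - ζ ω := by
    filter_upwards [hsol.equation t ζ hζ, hY2.ae_integrable, hG2.ae_integrable] with ω h1 h2 h3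
    have h4 : Integrable (fun s => a s * Y s ω + G s ω) hγ.vectorMeasure.variation := h2.add h3
    rw [h1, X.Ioc_finish, hσ.setIntegral_eq h4 measurableSet_Ioi]
    simp only [add_mul]
    rw [integral_add (hσ.integrable_mul h2).restrict (hσ.integrable_mul h3).restrict, hL,
      ContinuousLinearMap.comp_apply]
    ring
  have e1 : X.S (fun ω => L (Z ω)) g = L (X.S Z g) := X.S_clm_comp L hsol.memL2_Z.2 g
  have e2 : X.S ζ g = detIntegral ind (X.cameronMartin g) (truncIoc ind t X.finish (X.S Z g)) := by
    rw [hζ.2 g hg, X.S_clm_comp _ hsol.memL2_Z.2]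
  -- The cancellation of the two `Z`-terms, applied to the vector `X.S Z g`.
  have e3 : L (X.S Z g) + X.S ζ g = 0 := by
    rw [e2]
    exact hcancel _
  have m1 : MemLp (fun ω => ξ ω - ∫ s in Set.Ioi t, a s * Y s ω * σ s
      ∂hγ.vectorMeasure.variation) 2 P := hξ.2.sub fY.memLp_integral
  have m2 : MemLp (fun ω => ξ ω - (∫ s in Set.Ioi t, a s * Y s ω * σ s
      ∂hγ.vectorMeasure.variation) - ∫ s in Set.Ioi t, G s ω * σ s
      ∂hγ.vectorMeasure.variation) 2 P := m1.sub fG.memLp_integral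
  have m3 : MemLp (fun ω => ξ ω - (∫ s in Set.Ioi t, a s * Y s ω * σ s
      ∂hγ.vectorMeasure.variation) - (∫ s in Set.Ioi t, G s ω * σ s
      ∂hγ.vectorMeasure.variation) - L (Z ω)) 2 P := m2.sub hLZ
  rw [X.S_congr hae, X.S_sub m3 hζ.1.2, X.S_sub m2 hLZ, X.S_sub m1 fG.memLp_integral,
    X.S_sub hξ.2 fY.memLp_integral,
    X.S_integral fY, X.S_integral fG, e1]
  have c1 : ∀ s, X.S (fun ω => a s * Y s ω * σ s) g = a s * σ s * X.S (Y s) g := fun s => by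
    rw [X.S_mul_const, X.S_const_mul]
    ring
  have i1 := X.integrable_S fY g
  have i2 := X.integrable_S fG g
  simp only [c1] at i1 ⊢
  simp only [X.S_mul_const] at i2 ⊢
  rw [integral_add i1 i2]
  linear_combination -e3

/-- A mild solution determines a shifted quasi-conditional expectation of the modified terminal
value. -/
theorem IsMildSolution.isQuasiCondExp {X : CenteredGaussianProcess P T} {c : X.Integrands}
    (hsol : X.IsMildSolution hγ a G c ξ ind Y Z)
    (hX : X.HasIndefiniteWienerIntegral) (ha : Measurable a) (hγc : Continuous γ)
    (hint : Integrable a hγ.vectorMeasure.variation) (hG : X.IsAdaptedMeasurable G)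
    (hGint : X.SquareIntegrable hγ G) (hξ : X.MemL2 ξ) (u : Time T) :
    X.MemL2 (X.modifiedTerminal hγ a G ξ) ∧
    X.IsQuasiCondExp c u (X.modifiedTerminal hγ a G ξ)
      fun ω => X.expFactor hγ a u * Y u ω - X.weightedIntegral hγ a G u ω := by
  obtain ⟨σ, hσm, hσ1, hσν⟩ := exists_sign_density hγ.vectorMeasure
  have hσ : IsSignDensity hγ σ := ⟨hσm, hσ1, hσν⟩
  have := nullSingletonClass_variation hγc hγ
  have hG2 : IsSquareIntegrableField hγ.vectorMeasure.variation P G := ⟨hG.measurable, hGint⟩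
  have hY2 : IsSquareIntegrableField hγ.vectorMeasure.variation P fun s ω => a s * Y s ω :=
    ⟨(ha.comp measurable_fst).mul hsol.adapted.measurable, hsol.squareIntegrable⟩
  have hW := hσ.aestronglyMeasurable_weightedIntegral X hint ha hG hG2
  have hW2 : ∀ t, X.MemL2 (X.weightedIntegral hγ a G t) := fun t =>
    ⟨(hW t).1.mono (X.F_le_finish t), (hW t).2⟩
  have hterm : X.MemL2 (X.modifiedTerminal hγ a G ξ) := hξ.sub (hW2 _)
  have hη := ((hsol.memL2 u).const_mul (X.expFactor hγ a u)).sub (hW2 u)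
  refine ⟨hterm, hη, ?_⟩
  have hcont : Continuous fun h : X.Integrands =>
      X.S (X.modifiedTerminal hγ a G ξ) (X.dualTrunc u (h + c) - c) :=
    (X.continuous_S hterm.2).comp
      (((ContinuousLinearMap.continuous _).comp (continuous_id.add continuous_const)).sub
        continuous_const)
  -- Both sides are continuous in `h`, so the dense set of good integrators suffices.
  refine fun h => congrFun (hcont.ext_on hsol.appropriate (X.continuous_S hη.2) fun h hh => ?_) h
  have hS := fun t (hut : u ≤ t) => hsol.S_equation hX hσ hξ hY2 hG2 hh hut
  have hloc : ∀ s ≤ u, inner ℝ (X.indic s) (X.dualTrunc u (h + c) - c) =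
      inner ℝ (X.indic s) h := fun s hs => by
    rw [inner_sub_right, X.inner_indic_dualTrunc hX, min_eq_left hs, inner_add_right,
      add_sub_cancel_right]
  beta_reduce
  set g := X.dualTrunc u (h + c) - c with hgdef
  have c1 : ∀ s, X.S (fun ω => a s * Y s ω * σ s) g = a s * σ s * X.S (Y s) g := fun s => by
    rw [X.S_mul_const, X.S_const_mul]
    ring
  have c3 : ∀ s, X.S (fun ω => X.expFactor hγ a s * G s ω * σ s) g =
      X.expFactor hγ a s * (X.S (G s) g * σ s) := fun s => by
    rw [X.S_mul_const, X.S_const_mul, mul_assoc]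
  have i1 := X.integrable_S (hσ.field_mul hY2) g
  have i2 := X.integrable_S (hσ.field_mul hG2) g
  simp only [c1] at i1
  simp only [X.S_mul_const] at i2
  -- Variation of constants with `y = S(Y)(g)`, `x = S(ξ)(g)` and coefficient `a σ`.
  have hode := exp_mul_eq_of_integral_equation (hσ.integrable_mul hint) i2 i1 hS
  simp only [← hσ.expFactor_eq X hint] at hode
  have hlast : ∫ s in Set.Ioi u, X.expFactor hγ a s * (X.S (G s) g * σ s)
      ∂hγ.vectorMeasure.variation =
      X.S (X.weightedIntegral hγ a G X.finish) g - X.S (X.weightedIntegral hγ a G u) g := by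
    rw [← X.S_sub (hW2 _).2 (hW2 u).2, X.S_congr (hσ.weightedIntegral_finish X hint ha hG2 u),
      X.S_integral ((hσ.field_mul (hσ.field_expFactor_mul X hint ha hG2)).restrict _)]
    simp only [c3]
  have hYu : X.S (Y u) g = X.S (Y u) h :=
    X.S_eq_of_adapted (hsol.memL2 u).2 (hsol.adapted.adapted u) hloc
  have hWu : X.S (X.weightedIntegral hγ a G u) g = X.S (X.weightedIntegral hγ a G u) h :=
    X.S_eq_of_adapted (hW2 u).2 (hW u).1 hloc
  rw [show X.modifiedTerminal hγ a G ξ =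
    fun ω => ξ ω - X.weightedIntegral hγ a G X.finish ω from rfl, X.S_sub hξ.2 (hW2 _).2,
    X.S_sub ((hsol.memL2 u).const_mul _).2 (hW2 u).2, X.S_const_mul, ← hYu, ← hWu, hode, hlast]
  ring

/-- Two candidates share their `S`-transform, so the chosen one is almost surely any other. -/
theorem quasiCondExp_ae_eq {u : Time T} {η : Ω → ℝ} (h : X.IsQuasiCondExp c u ξ η) :
    X.quasiCondExp c u ξ =ᵐ[P] η := by
  have hex : ∃ η, X.IsQuasiCondExp c u ξ η := ⟨η, h⟩
  rw [quasiCondExp, dif_pos hex]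
  exact X.eq_of_S_eq hex.choose_spec.1 h.1 fun k => (hex.choose_spec.2 k).symm.trans (h.2 k)

theorem IsMildSolution.ae_eq {X : CenteredGaussianProcess P T} {c : X.Integrands}
    (hsol : X.IsMildSolution hγ a G c ξ ind Y Z)
    (hX : X.HasIndefiniteWienerIntegral) (ha : Measurable a) (hγc : Continuous γ)
    (hint : Integrable a hγ.vectorMeasure.variation) (hG : X.IsAdaptedMeasurable G)
    (hGint : X.SquareIntegrable hγ G) (hξ : X.MemL2 ξ) (u : Time T) :
    ∀ᵐ ω ∂P, Y u ω =
      (X.expFactor hγ a u)⁻¹ * X.quasiCondExp c u (X.modifiedTerminal hγ a G ξ) ω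
        + (X.expFactor hγ a u)⁻¹ * X.weightedIntegral hγ a G u ω := by
  have hA : X.expFactor hγ a u ≠ 0 := (Real.exp_pos _).ne'
  filter_upwards [X.quasiCondExp_ae_eq
    (hsol.isQuasiCondExp hX ha hγc hint hG hGint hξ u).2] with ω hω
  rw [hω]
  field_simp
  ring

end Solution

end BSDE

end CenteredGaussianProcess

end GaussianBSDE

end

theorem theorem3p6 {Ω : Type*} [MeasurableSpace Ω] (P : Measure Ω) [IsProbabilityMeasure P]
    {T : ℝ} (X : GaussianBSDE.CenteredGaussianProcess P T)
    (hX : X.HasIndefiniteWienerIntegral)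
    (a : GaussianBSDE.Time T → ℝ) (ha : Measurable a)
    (γ : GaussianBSDE.Time T → ℝ) (hγc : Continuous γ) (hγ : BoundedVariationOn γ Set.univ)
    (hint : Integrable a hγ.vectorMeasure.variation)
    (G : GaussianBSDE.Time T → Ω → ℝ) (hG : X.IsAdaptedMeasurable G)
    (hGint : X.SquareIntegrable hγ G)
    (c : X.Integrands) (ξ : Ω → ℝ) (hξ : X.MemL2 ξ)
    {H : Type*} [NormedAddCommGroup H] [InnerProductSpace ℝ H] [CompleteSpace H]
    (ind : GaussianBSDE.Time T → H) (Y : GaussianBSDE.Time T → Ω → ℝ) (Z : Ω → H)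
    (hsol : X.IsMildSolution hγ a G c ξ ind Y Z) :
    (∀ t, X.modifiedTerminal hγ a G ξ ∈ X.quasiDomain c t ∧
      ∀ᵐ ω ∂P, Y t ω =
        (X.expFactor hγ a t)⁻¹ * X.quasiCondExp c t (X.modifiedTerminal hγ a G ξ) ω
          + (X.expFactor hγ a t)⁻¹ * X.weightedIntegral hγ a G t ω) ∧
    ∀ {H' : Type*} [NormedAddCommGroup H'] [InnerProductSpace ℝ H'] [CompleteSpace H']
      (ind' : GaussianBSDE.Time T → H') (Y' : GaussianBSDE.Time T → Ω → ℝ) (Z' : Ω → H'),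
      X.IsMildSolution hγ a G c ξ ind' Y' Z' → ∀ t, Y' t =ᵐ[P] Y t :=
  ⟨fun t =>
    have h := hsol.isQuasiCondExp hX ha hγc hint hG hGint hξ t
    ⟨⟨h.1, _, h.2⟩, hsol.ae_eq hX ha hγc hint hG hGint hξ t⟩,
  fun _ _ _ hsol' t => by
    filter_upwards [hsol.ae_eq hX ha hγc hint hG hGint hξ t,
      hsol'.ae_eq hX ha hγc hint hG hGint hξ t] with ω h1 h2
    rw [h1, h2]⟩
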